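/- Let $L \subseteq \{0,1\}^*$ be any infinite language, and let $x = (x_n)_{n \ge 0}$ be a sequence of independent random strings, $x_n$ uniformly distributed on $\{0,1\}^n$. Let $f_n(z,y) = 1$ if $z = x_n$ and $y \in L$, and $f_n(z,y) = 0$ otherwise, for $z,y \in \{0,1\}^n$. Let $\mathcal{O}_n$ be the standard oracle on $2n+1$ qubits given by $\mathcal{O}_n |z\rangle |y\rangle |c\rangle = |z\rangle |y\rangle |c \oplus f_n(z,y)\rangle$; that is, it applies $X$ to the last qubit exactly when the first register is $x_n$ and $y \in L$, and acts as the identity on all other computational basis states. Let $$U_n = (H_n \otimes \hat 1_{n+1})\, \mathcal{O}_n\, (H_n \otimes \hat 1_{n+1}),$$ where $H_n = H^{\otimes n}$ is the Hadamard transform on the first $n$ qubits. Then, with probability one over the choice of $x$, all three of the following hold: 1. $\mathrm{NP}^{(\mathcal{O}_n)} \not\subseteq \mathrm{BQP}^{(\mathcal{O}_n)}$; 2. $\mathrm{P}^{(\mathcal{O}_n)}/\mathrm{poly} \not\subseteq \mathrm{BQP}^{(\mathcal{O}_n)}$; 3. $\mathrm{QCMA}^{(U_n)} \not\subseteq \mathrm{BQP}^{(U_n)}$.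 In particular such $(x_n)$ exist for every infinite $L$. Here $\mathrm{NP}^{(\mathcal{O}_n)}$ and $\mathrm{P}^{(\mathcal{O}_n)}/\mathrm{poly}$ are defined by deterministic polynomial-time machines (multi-stack Turing machines) that may query any string $zy$ with $|z|=|y|=n$, for any $n$, at unit cost, receiving $f_n(z,y)$, and that get besides the input a witness, respectively an advice string depending only on the input length, of polynomially bounded length. $\mathrm{BQP}^{(V_n)}$ is the class of languages decided with error at most $1/3$ by quantum circuits $(C_n)$, one for each input length, over Hadamard, $T$, CNOT, Toffoli gates and gates $V_m$ ($m$ arbitrary) applied to any $2m+1$ distinct qubits, where a description of $C_n$ is computed from $1^n$ in polynomial time by a machine without oracle. $\mathrm{QCMA}^{(V_n)}$ is the class of languages with such a verifier circuit that takes a classical witness of polynomial length in addition to the input, with completeness at least $2/3$ and soundness error at most $1/3$. -/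

import Mathlib

namespace MarkedOracle

/-! ### Oracle families -/

/-- A family of Boolean functions `f n : {0,1}^n × {0,1}^n → {0,1}`. -/
abbrev BoolOracle : Type := (n : ℕ) → (Fin n → Bool) → (Fin n → Bool) → Bool

/-- The `2n+1` qubits on which the `n`-th quantum oracle acts: an `n`-qubit first register,
an `n`-qubit second register, and a single last qubit. -/
abbrev OracleWire (n : ℕ) : Type := Fin n ⊕ Fin n ⊕ Unit

/-- The content of the first register of a computational basis state. -/
def regFst {n : ℕ} (b : OracleWire n → Bool) : Fin n → Bool := fun i => b (Sum.inl i)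

/-- The content of the second register of a computational basis state. -/
def regSnd {n : ℕ} (b : OracleWire n → Bool) : Fin n → Bool := fun i => b (Sum.inr (Sum.inl i))

/-- The content of the last qubit of a computational basis state. -/
def regBit {n : ℕ} (b : OracleWire n → Bool) : Bool := b (Sum.inr (Sum.inr ()))

/-- A family of operators on `2n+1` qubits, as matrices in the computational basis. -/
abbrev QuantumOracle : Type :=
  (n : ℕ) → Matrix (OracleWire n → Bool) (OracleWire n → Bool) ℂ

/-- The standard oracle of `f`: `|z⟩|y⟩|c⟩ ↦ |z⟩|y⟩|c ⊕ f n z y⟩`. -/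
noncomputable def BoolOracle.toQuantum (f : BoolOracle) : QuantumOracle := fun n =>
  Matrix.of fun out inp =>
    if regFst out = regFst inp ∧ regSnd out = regSnd inp ∧
        regBit out = xor (regBit inp) (f n (regFst inp) (regSnd inp)) then 1 else 0

/-- `H_n ⊗ 1_{n+1}`: the `n`-qubit Hadamard transform on the first register. -/
noncomputable def hadamardFst (n : ℕ) :
    Matrix (OracleWire n → Bool) (OracleWire n → Bool) ℂ :=
  Matrix.of fun out inp =>
    if regSnd out = regSnd inp ∧ regBit out = regBit inp then
      ∏ i : Fin n, ((if regFst out i && regFst inp i then -1 else 1) / (Real.sqrt 2 : ℂ))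
    else 0

/-- Conjugation of each oracle of a family by `H_n ⊗ 1_{n+1}`. -/
noncomputable def QuantumOracle.hadamardConj (U : QuantumOracle) : QuantumOracle := fun n =>
  hadamardFst n * U n * hadamardFst n

open Classical in
/-- The bit computed by the oracle with hidden strings `x n` and language `L`: it is `1`
exactly when the first register holds `x n` and the second a string of `L`. -/
noncomputable def hiddenBit (x : (n : ℕ) → Fin n → Bool) (L : Language Bool) : BoolOracle :=
  fun n z y => decide (z = x n ∧ List.ofFn y ∈ L)

/-- The standard oracles `O_n`. -/
noncomputable def standardOracle (x : (n : ℕ) → Fin n → Bool) (L : Language Bool) :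
    QuantumOracle :=
  (hiddenBit x L).toQuantum

/-- The Hadamard-conjugated quantum oracles `U_n`. -/
noncomputable def hadamardOracle (x : (n : ℕ) → Fin n → Bool) (L : Language Bool) :
    QuantumOracle :=
  (standardOracle x L).hadamardConj

/-! ### Classical oracle machines

Multi-stack Turing machines with a binary stack alphabet and finite control (two stacks hold
the two halves of a tape, so this is a multi-tape Turing machine up to a constant factor). -/

/-- The instructions of a program; each instruction names the labels of its successors. -/
inductive Instr : Type
  | push (k : ℕ) (b : Bool) (next : ℕ)
  | pop (k : ℕ) (onEmpty onFalse onTrue : ℕ)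
  | query (k : ℕ) (onFalse onTrue : ℕ)
  | halt (accept : Bool)

/-- A program is a finite list of instructions, labelled by their positions. It uses only the
finitely many stacks named in its instructions. -/
abbrev Program : Type := List Instr

/-- A query is a bit string, read on a stack from its top. The string `z ++ y`, with `z` and `y`
of equal length `n`, is answered by `f n z y`; strings of odd length are answered by `false`. -/
noncomputable def BoolOracle.answer (f : BoolOracle) (s : List Bool) : Bool :=
  open Classical in
  decide (∃ (n : ℕ) (z y : Fin n → Bool), s = List.ofFn z ++ List.ofFn y ∧ f n z y = true)

/-- `run A P t pc stk` is the result of running `P`, with oracle answers `A`, from the label `pc`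
and the stack contents `stk` for at most `t` steps: the accept bit and the final stacks if it
halts within `t` steps, and `none` otherwise. A jump to a label outside the program rejects. -/
def run (A : List Bool → Bool) (P : Program) :
    ℕ → ℕ → (ℕ → List Bool) → Option (Bool × (ℕ → List Bool))
  | 0, _, _ => none
  | t + 1, pc, stk =>
    match P[pc]? with
    | none => some (false, stk)
    | some (Instr.halt b) => some (b, stk)
    | some (Instr.push k b next) => run A P t next (Function.update stk k (b :: stk k))
    | some (Instr.pop k onEmpty onFalse onTrue) =>
      match stk k with
      | [] => run A P t onEmpty stk
      | false :: s => run A P t onFalse (Function.update stk k s)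
      | true :: s => run A P t onTrue (Function.update stk k s)
    | some (Instr.query k onFalse onTrue) =>
      if A (stk k) then run A P t onTrue stk else run A P t onFalse stk

/-- Initial stacks: the input `u` on stack `0`, a second argument `w` (a witness or an advice
string) on stack `1`, all other stacks empty. -/
def initStacks (u w : List Bool) : ℕ → List Bool
  | 0 => u
  | 1 => w
  | _ + 2 => []

/-- `P` halts on all pairs of arguments in time polynomial in their total length. -/
def RunsInPolyTime (A : List Bool → Bool) (P : Program) : Prop :=
  ∃ p : Polynomial ℕ, ∀ u w : List Bool,
    (run A P (p.eval (u.length + w.length)) 0 (initStacks u w)).isSome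

/-- `P` accepts the pair of arguments `u`, `w`. -/
def Accepts (A : List Bool → Bool) (P : Program) (u w : List Bool) : Prop :=
  ∃ (t : ℕ) (s : ℕ → List Bool), run A P t 0 (initStacks u w) = some (true, s)

/-- `NP` relative to the standard oracles of `f`. -/
def NP (f : BoolOracle) : Set (Language Bool) :=
  {K | ∃ (P : Program) (p : Polynomial ℕ), RunsInPolyTime f.answer P ∧
    ∀ u : List Bool, u ∈ K ↔
      ∃ w : List Bool, w.length ≤ p.eval u.length ∧ Accepts f.answer P u w}

/-- `P/poly` relative to the standard oracles of `f`: deterministic polynomial time with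
polynomially long advice that depends only on the input length. -/
def PPoly (f : BoolOracle) : Set (Language Bool) :=
  {K | ∃ (P : Program) (p : Polynomial ℕ) (advice : ℕ → List Bool),
    RunsInPolyTime f.answer P ∧ (∀ n, (advice n).length ≤ p.eval n) ∧
    ∀ u : List Bool, u ∈ K ↔ Accepts f.answer P u (advice u.length)}

/-! ### Quantum circuits with oracle gates -/

/-- Elementary gates on `N` qubits: Hadamard, `T = diag(1, e^{iπ/4})`, CNOT, Toffoli, and a call
of the `n`-th oracle on distinct qubits listed by `q`. -/
inductive Gate (N : ℕ) : Type
  | hadamard (i : Fin N)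
  | phase (i : Fin N)
  | cnot (c t : Fin N) (h : c ≠ t)
  | toffoli (c d t : Fin N) (hcd : c ≠ d) (hct : c ≠ t) (hdt : d ≠ t)
  | oracle (n : ℕ) (q : OracleWire n ↪ Fin N)

/-- The action of a gate on state vectors (amplitudes indexed by computational basis states). -/
noncomputable def Gate.act (U : QuantumOracle) {N : ℕ} :
    Gate N → ((Fin N → Bool) → ℂ) → (Fin N → Bool) → ℂ
  | .hadamard i, ψ => fun b =>
      (ψ (Function.update b i false) + (if b i then -1 else 1) * ψ (Function.update b i true)) /
        (Real.sqrt 2 : ℂ)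
  | .phase i, ψ => fun b =>
      (if b i then Complex.exp (Complex.I * Real.pi / 4) else 1) * ψ b
  | .cnot c t _, ψ => fun b => ψ (Function.update b t (xor (b t) (b c)))
  | .toffoli c d t _ _ _, ψ => fun b => ψ (Function.update b t (xor (b t) (b c && b d)))
  | .oracle n q, ψ => fun b =>
      ∑ a : OracleWire n → Bool, U n (fun j => b (q j)) a * ψ (Function.extend q a b)

/-- A circuit on `width + 1` qubits; the last qubit is the output qubit. -/
structure Circuit : Type where
  width : ℕ
  gates : List (Gate (width + 1))

/-- The final state of a circuit started in the basis state that holds `u` on the first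
`u.length` qubits and `0` on the others. The gates are applied from left to right. -/
noncomputable def Circuit.finalState (U : QuantumOracle) (C : Circuit) (u : List Bool) :
    (Fin (C.width + 1) → Bool) → ℂ :=
  C.gates.foldl (fun ψ g => g.act U ψ) (Pi.single (fun i => u.getD i false) 1)

/-- The probability that measuring the output qubit in the computational basis gives `1`. -/
noncomputable def Circuit.acceptProb (U : QuantumOracle) (C : Circuit) (u : List Bool) : ℝ :=
  ∑ b : Fin (C.width + 1) → Bool,
    if b (Fin.last C.width) then ‖C.finalState U u b‖ ^ 2 else 0

/-- Opcode and qubits of a gate, as a list of numbers. -/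
def Gate.data {N : ℕ} : Gate N → List ℕ
  | .hadamard i => [0, i]
  | .phase i => [1, i]
  | .cnot c t _ => [2, c, t]
  | .toffoli c d t _ _ _ => [3, c, d, t]
  | .oracle n q =>
      [4, n] ++ List.ofFn (fun i : Fin n => (q (Sum.inl i) : ℕ)) ++
        List.ofFn (fun i : Fin n => (q (Sum.inr (Sum.inl i)) : ℕ)) ++
        [(q (Sum.inr (Sum.inr ())) : ℕ)]

/-- The description of a circuit as a bit string: the width and the data of all gates, each number
`k` being written as `k` ones followed by a zero. -/
def Circuit.code (C : Circuit) : List Bool :=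
  (C.width :: C.gates.flatMap Gate.data).flatMap fun k => List.replicate k true ++ [false]

/-- Polynomial-time uniformity: some program without oracle writes, on input `1^n`, the
description of `C n` on stack `1` in time polynomial in `n`. -/
def PolyTimeGenerated (C : ℕ → Circuit) : Prop :=
  ∃ (P : Program) (p : Polynomial ℕ), ∀ n : ℕ, ∃ (b : Bool) (s : ℕ → List Bool),
    run (fun _ => false) P (p.eval n) 0 (initStacks (List.replicate n true) []) = some (b, s) ∧
      s 1 = (C n).code

/-- `BQP` relative to `U`. -/
def BQP (U : QuantumOracle) : Set (Language Bool) :=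
  {K | ∃ C : ℕ → Circuit, PolyTimeGenerated C ∧ (∀ n, n ≤ (C n).width) ∧
    ∀ u : List Bool,
      (u ∈ K → 2 / 3 ≤ (C u.length).acceptProb U u) ∧
      (u ∉ K → (C u.length).acceptProb U u ≤ 1 / 3)}

/-- `QCMA` relative to `U`: a quantum verifier and a classical witness of length `p n`. -/
def QCMA (U : QuantumOracle) : Set (Language Bool) :=
  {K | ∃ (C : ℕ → Circuit) (p : Polynomial ℕ), PolyTimeGenerated C ∧
    (∀ n, n + p.eval n ≤ (C n).width) ∧
    ∀ u : List Bool,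
      (u ∈ K → ∃ w : List Bool, w.length = p.eval u.length ∧
        2 / 3 ≤ (C u.length).acceptProb U (u ++ w)) ∧
      (u ∉ K → ∀ w : List Bool, w.length = p.eval u.length →
        (C u.length).acceptProb U (u ++ w) ≤ 1 / 3)}

/-! ### Random hidden strings -/

/-- The law of a sequence of independent strings `x n`, each uniform on `{0,1}^n`. -/
noncomputable def hiddenLaw : MeasureTheory.Measure ((n : ℕ) → Fin n → Bool) :=
  MeasureTheory.Measure.infinitePi fun n => (PMF.uniformOfFintype (Fin n → Bool)).toMeasure

instance : MeasureTheory.IsProbabilityMeasure hiddenLaw := by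
  unfold hiddenLaw
  infer_instance

end MarkedOracle

/-! The separating language `hiddenLanguage x L` consists of the strings of `L` at whose length the
hidden string begins with 1. Given the hidden string as witness or as advice, one oracle query
confirms that string and the membership in `L` at once, so the language lies in NP and in P/poly
however complex `L` is. With the oracles `U_n` a quantum verifier does the same, because Hadamard
gates around the call undo the conjugation.

A quantum circuit without such help cannot find the hidden string. For a fixed state `φ`, the sum of
`‖(O_n - 1) φ‖²` over all values of the `n`-th string is at most `4 ‖φ‖²`, since each basis state is
affected by one value only; conjugation by a unitary preserves this bound (`HidesStrings`). By the
hybrid argument, a circuit with `T` gates accepts, for all but `576 T²` values, with probability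
within 1/6 of the one it has when the `n`-th oracle is replaced by the identity
(`HidesStrings.card_acceptProb_le`). The latter probability carries no information on the first bit,
so for polynomial `T` and large `n` the circuit is right for at most three quarters of the values,
whatever the other strings are (`ncard_decidesFirstBit_le`).

Since `L` contains arbitrarily long strings, `k` such constraints can be imposed at widely spaced
lengths, with joint probability at most `(3/4)^k`. Hence a fixed circuit family decides the language
with probability zero (`hiddenLaw_eq_zero`). There are only countably many uniform families
(`countable_polyTimeGenerated`), so almost surely none of them does. -/

namespace MarkedOracle

open Matrix MeasureTheory

/-! ### Runs of programs -/

/-- From label `pc` with stacks `s`, the program reaches label `pc'` with stacks `s'` in at most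
`t` steps. -/
def Reach (A : List Bool → Bool) (P : Program) (pc : ℕ) (s : ℕ → List Bool) (pc' : ℕ)
    (s' : ℕ → List Bool) (t : ℕ) : Prop :=
  ∃ t' ≤ t, ∀ m, run A P (m + t') pc s = run A P m pc' s'

section Reach

variable {A : List Bool → Bool} {P : Program} {pc pc₁ pc₂ : ℕ} {s s₁ s₂ : ℕ → List Bool}

theorem Reach.refl : Reach A P pc s pc s 0 := ⟨0, le_rfl, fun _ => rfl⟩

theorem Reach.mono {t t' : ℕ} (h : Reach A P pc s pc₁ s₁ t) (ht : t ≤ t') :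
    Reach A P pc s pc₁ s₁ t' := by
  obtain ⟨k, hk, h⟩ := h
  exact ⟨k, hk.trans ht, h⟩

theorem Reach.trans {t t' : ℕ} (h : Reach A P pc s pc₁ s₁ t) (h' : Reach A P pc₁ s₁ pc₂ s₂ t') :
    Reach A P pc s pc₂ s₂ (t + t') := by
  obtain ⟨k, hk, h⟩ := h
  obtain ⟨k', hk', h'⟩ := h'
  refine ⟨k + k', by omega, fun m => ?_⟩
  rw [show m + (k + k') = (m + k') + k by omega, h, h']

theorem reach_push {k : ℕ} {b : Bool} {next : ℕ} (h : P[pc]? = some (.push k b next)) :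
    Reach A P pc s next (Function.update s k (b :: s k)) 1 :=
  ⟨1, le_rfl, fun m => by simp [run, h]⟩

theorem reach_pop_nil {k e f g : ℕ} (h : P[pc]? = some (.pop k e f g)) (hs : s k = []) :
    Reach A P pc s e s 1 :=
  ⟨1, le_rfl, fun m => by simp [run, h, hs]⟩

theorem reach_pop_cons {k e f g : ℕ} {b : Bool} {r : List Bool}
    (h : P[pc]? = some (.pop k e f g)) (hs : s k = b :: r) :
    Reach A P pc s (if b then g else f) (Function.update s k r) 1 :=
  ⟨1, le_rfl, fun m => by cases b <;> simp [run, h, hs]⟩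

theorem reach_query {k f g : ℕ} (h : P[pc]? = some (.query k f g)) :
    Reach A P pc s (if A (s k) then g else f) s 1 :=
  ⟨1, le_rfl, fun m => by by_cases hA : A (s k) <;> simp [run, h, hA]⟩

theorem run_mono_succ {t : ℕ} {r : Bool × (ℕ → List Bool)} (h : run A P t pc s = some r) :
    run A P (t + 1) pc s = some r := by
  induction t generalizing pc s with
  | zero => simp [run] at h
  | succ t ih =>
    rw [run] at h ⊢
    rcases hP : P[pc]? with _ | ⟨k, b, n⟩ | ⟨k, e, f, g⟩ | ⟨k, f, g⟩ | b
    · simpa [hP] using h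
    · rw [hP] at h
      exact ih h
    · rw [hP] at h
      dsimp only at h ⊢
      rcases hs : s k with _ | ⟨_ | _, r⟩ <;> rw [hs] at h <;> exact ih h
    · rw [hP] at h
      dsimp only at h ⊢
      split_ifs at h ⊢ <;> exact ih h
    · simpa [hP] using h

theorem run_mono {t t' : ℕ} {r : Bool × (ℕ → List Bool)} (h : run A P t pc s = some r)
    (ht : t ≤ t') : run A P t' pc s = some r := by
  induction t', ht using Nat.le_induction with
  | base => exact h
  | succ n _ ih => exact run_mono_succ ih

theorem run_unique {t t' : ℕ} {r r' : Bool × (ℕ → List Bool)} (h : run A P t pc s = some r)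
    (h' : run A P t' pc s = some r') : r = r' := by
  have h₁ := run_mono h (le_max_left t t')
  rw [run_mono h' (le_max_right t t')] at h₁
  exact (Option.some_injective _ h₁).symm

theorem Reach.run_halt {t t' : ℕ} {b : Bool} (h : Reach A P pc s pc₁ s₁ t)
    (hP : P[pc₁]? = some (.halt b)) (ht : t + 1 ≤ t') : run A P t' pc s = some (b, s₁) := by
  obtain ⟨k, hk, h⟩ := h
  refine run_mono (t := 1 + k) ?_ (by omega)
  rw [h]
  simp [run, hP]

/-- One step pushes at most one bit. This is what bounds the size of a uniformly generated circuit
by a polynomial. -/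
theorem length_le_of_run {t : ℕ} {r : Bool × (ℕ → List Bool)} (h : run A P t pc s = some r)
    (j : ℕ) : (r.2 j).length ≤ (s j).length + t := by
  induction t generalizing pc s with
  | zero => simp [run] at h
  | succ t ih =>
    have key : ∀ (k : ℕ) (l : List Bool), l.length ≤ (s k).length + 1 →
        (Function.update s k l j).length ≤ (s j).length + 1 := by
      intro k l hl
      by_cases hjk : j = k
      · subst hjk; simpa using hl
      · simp [Function.update_of_ne hjk]
    rw [run] at h
    rcases hP : P[pc]? with _ | ⟨k, b, n⟩ | ⟨k, e, f, g⟩ | ⟨k, f, g⟩ | b <;> rw [hP] at h <;>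
      dsimp only at h
    · cases h; simp
    · have := ih h
      have := key k (b :: s k) (by simp)
      omega
    · rcases hs : s k with _ | ⟨_ | _, r'⟩ <;> rw [hs] at h <;> have h₁ := ih h
      · omega
      · have := key k r' (by simp [hs]; omega)
        omega
      · have := key k r' (by simp [hs]; omega)
        omega
    · split_ifs at h <;> have h₁ := ih h <;> omega
    · cases h; simp

end Reach

/-! ### A program verifying the hidden string -/

/-- Four stacks with given contents, the others being empty. -/
def fourStacks (a b c d : List Bool) : ℕ → List Bool
  | 0 => a
  | 1 => b
  | 2 => c
  | 3 => d
  | _ + 4 => []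

section FourStacks

variable (a b c d e : List Bool)

theorem initStacks_eq_fourStacks : initStacks a b = fourStacks a b [] [] := by
  funext k
  rcases k with _ | _ | _ | _ | k <;> rfl

@[simp] theorem fourStacks_zero : fourStacks a b c d 0 = a := rfl
@[simp] theorem fourStacks_one : fourStacks a b c d 1 = b := rfl
@[simp] theorem fourStacks_two : fourStacks a b c d 2 = c := rfl
@[simp] theorem fourStacks_three : fourStacks a b c d 3 = d := rfl

@[simp] theorem update_fourStacks_zero :
    Function.update (fourStacks a b c d) 0 e = fourStacks e b c d := by
  funext k
  rcases k with _ | _ | _ | _ | k <;> simp [Function.update, fourStacks]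

@[simp] theorem update_fourStacks_one :
    Function.update (fourStacks a b c d) 1 e = fourStacks a e c d := by
  funext k
  rcases k with _ | _ | _ | _ | k <;> simp [Function.update, fourStacks]

@[simp] theorem update_fourStacks_two :
    Function.update (fourStacks a b c d) 2 e = fourStacks a b e d := by
  funext k
  rcases k with _ | _ | _ | _ | k <;> simp [Function.update, fourStacks]

@[simp] theorem update_fourStacks_three :
    Function.update (fourStacks a b c d) 3 e = fourStacks a b c e := by
  funext k
  rcases k with _ | _ | _ | _ | k <;> simp [Function.update, fourStacks]

end FourStacks

/-- The three instructions form a loop that costs two steps per bit, plus one to find stack `i`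
empty. The order is reversed, which restores strings that an earlier pass has reversed. -/
theorem reach_transfer {A : List Bool → Bool} {P : Program} {pc e f g i j : ℕ} (hij : i ≠ j)
    (h : P[pc]? = some (.pop i e f g)) (hf : P[f]? = some (.push j false pc))
    (hg : P[g]? = some (.push j true pc)) (l : List Bool) (s : ℕ → List Bool) (hs : s i = l) :
    Reach A P pc s e
      (Function.update (Function.update s i []) j (l.reverse ++ s j)) (2 * l.length + 1) := by
  induction l generalizing s with
  | nil =>
    rw [Function.update_eq_self_iff (a := i) |>.2 hs.symm, List.reverse_nil, List.nil_append,
      Function.update_eq_self]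
    exact reach_pop_nil h hs
  | cons b l ih =>
    have h₁ := reach_pop_cons (A := A) h hs
    set s₁ := Function.update s i l with hs₁
    have h₂ : Reach A P (if b then g else f) s₁ pc (Function.update s₁ j (b :: s₁ j)) 1 := by
      cases b
      · exact reach_push hf
      · exact reach_push hg
    have h₃ := ih (Function.update s₁ j (b :: s₁ j)) (by simp [hs₁, hij])
    convert ((h₁.trans h₂).trans h₃).mono (t' := 2 * (b :: l).length + 1)
      (by rw [List.length_cons]; omega) using 1
    funext k
    by_cases hk : k = j
    · subst hk; simp [hs₁, Function.update_of_ne hij.symm]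
    · by_cases hki : k = i
      · subst hki; simp [hij]
      · simp [hs₁, hk, hki]

/-- On a pair `u`, `w` of strings of equal length, query `w ++ u`, and accept if the answer is
`true` and the string begins with `true`; reject if the lengths differ. -/
def hiddenVerifier : Program :=
  -- Labels 0 to 5 move input and witness in parallel to stacks 3 and 2; 6 rejects; 7 tests that no
  -- witness bit is left over; 8 to 10 bring the input back to stack 0, and 11 to 13 put the witness
  -- on top of it; 14 queries, 15 tests the first bit, 16 accepts.
  [.pop 0 7 1 2, .push 3 false 3, .push 3 true 3, .pop 1 6 4 5, .push 2 false 0, .push 2 true 0,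
    .halt false, .pop 1 8 6 6, .pop 3 11 9 10, .push 0 false 8, .push 0 true 8,
    .pop 2 14 12 13, .push 0 false 11, .push 0 true 11, .query 0 6 15, .pop 0 6 6 16, .halt true]

section HiddenVerifier

variable {A : List Bool → Bool}

theorem hiddenVerifier_step (a b : Bool) (u w c d : List Bool) :
    Reach A hiddenVerifier 0 (fourStacks (a :: u) (b :: w) c d) 0
      (fourStacks u w (b :: c) (a :: d)) 4 := by
  refine ⟨4, le_rfl, fun m => ?_⟩
  cases a <;> cases b <;> simp [run, hiddenVerifier]

theorem hiddenVerifier_split (u w w' c d : List Bool) (h : w.length = u.length) :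
    Reach A hiddenVerifier 0 (fourStacks u (w ++ w') c d) 7
      (fourStacks [] w' (w.reverse ++ c) (u.reverse ++ d)) (4 * u.length + 1) := by
  induction u generalizing w c d with
  | nil =>
    obtain rfl := List.length_eq_zero_iff.1 h
    exact ⟨1, by simp, fun m => by simp [run, hiddenVerifier]⟩
  | cons a u ih =>
    obtain _ | ⟨b, w⟩ := w
    · simp at h
    · have := (hiddenVerifier_step (A := A) a b u (w ++ w') c d).trans
        (ih w (b :: c) (a :: d) (by simpa using h))
      simpa [Nat.mul_add, Nat.add_comm, Nat.add_left_comm] using this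

theorem hiddenVerifier_short (u w c d : List Bool) (h : w.length < u.length) :
    ∃ s, Reach A hiddenVerifier 0 (fourStacks u w c d) 6 s (4 * u.length) := by
  induction u generalizing w c d with
  | nil => simp at h
  | cons a u ih =>
    obtain _ | ⟨b, w⟩ := w
    · refine ⟨fourStacks u [] c (a :: d), 3, by simp; omega, fun m => ?_⟩
      cases a <;> simp [run, hiddenVerifier]
    · obtain ⟨s, hs⟩ := ih w (b :: c) (a :: d) (by simpa using h)
      exact ⟨s, ((hiddenVerifier_step a b u w c d).trans hs).mono (by simp; omega)⟩

theorem run_hiddenVerifier (A : List Bool → Bool) (u w : List Bool) :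
    -- Splitting takes `4n + 1` steps, the two transfers `2n + 1` each, the remaining instructions
    -- one each. An overlong witness costs nothing more, as a single surplus bit leads to rejection.
    ∃ b s, run A hiddenVerifier (8 * u.length + 10) 0 (initStacks u w) = some (b, s) ∧
      (b = true ↔ w.length = u.length ∧ A (w ++ u) = true ∧ (w ++ u).head? = some true) := by
  rw [initStacks_eq_fourStacks]
  rcases lt_or_ge w.length u.length with hlt | hge
  · obtain ⟨s, hs⟩ := hiddenVerifier_short (A := A) u w [] [] hlt
    refine ⟨false, s, hs.run_halt rfl (by omega), ?_⟩
    simp only [Bool.false_eq_true, false_iff]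
    omega
  have hsplit := hiddenVerifier_split (A := A) u (w.take u.length) (w.drop u.length) [] []
    (by simpa using hge)
  rw [List.take_append_drop] at hsplit
  rcases hge.lt_or_eq with hlt | heq
  · obtain ⟨b, r, hr⟩ : ∃ b r, w.drop u.length = b :: r := by
      rcases h : w.drop u.length with _ | ⟨b, r⟩
      · simp at h
        omega
      · exact ⟨b, r, rfl⟩
    rw [hr] at hsplit
    have h₂ := hsplit.trans (reach_pop_cons (k := 1) (e := 8) (f := 6) (g := 6) (b := b) (r := r)
      rfl rfl)
    rw [ite_self] at h₂
    refine ⟨false, _, h₂.run_halt rfl (by omega), ?_⟩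
    simp only [Bool.false_eq_true, false_iff]
    omega
  · rw [heq, List.drop_length, List.take_length, ← heq] at hsplit
    have h₂ := hsplit.trans (reach_pop_nil (k := 1) (e := 8) (f := 6) (g := 6) rfl rfl)
    have h₃ := h₂.trans (reach_transfer (i := 3) (j := 0) (e := 11) (f := 9) (g := 10)
      (by norm_num) rfl rfl rfl _ _ rfl)
    have h₄ := h₃.trans (reach_transfer (i := 2) (j := 0) (e := 14) (f := 12) (g := 13)
      (by norm_num) rfl rfl rfl _ _ rfl)
    simp only [fourStacks_three, fourStacks_zero, fourStacks_two, update_fourStacks_three,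
      update_fourStacks_zero, update_fourStacks_two, List.append_nil, List.reverse_reverse,
      List.length_reverse] at h₄
    have h₅ := h₄.trans (reach_query (k := 0) (f := 6) (g := 15) rfl)
    rw [fourStacks_zero] at h₅
    by_cases hA : A (w ++ u) = true
    · rw [if_pos hA] at h₅
      rcases hwu : w ++ u with _ | ⟨b, r⟩
      · rw [hwu] at h₅
        have h₆ := h₅.trans (reach_pop_nil (k := 0) (e := 6) (f := 6) (g := 16) rfl rfl)
        exact ⟨false, _, h₆.run_halt rfl (by omega), by simp⟩
      · rw [hwu] at h₅ hA
        have h₆ := h₅.trans (reach_pop_cons (k := 0) (e := 6) (f := 6) (g := 16) rfl rfl)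
        cases b
        · exact ⟨false, _, h₆.run_halt rfl (by omega), by simp⟩
        · exact ⟨true, _, h₆.run_halt rfl (by omega), by simp [heq, hA]⟩
    · rw [if_neg hA] at h₅
      exact ⟨false, _, h₅.run_halt rfl (by omega), by simp [hA]⟩

theorem accepts_hiddenVerifier (u w : List Bool) :
    Accepts A hiddenVerifier u w ↔
      w.length = u.length ∧ A (w ++ u) = true ∧ (w ++ u).head? = some true := by
  obtain ⟨b, s, h, hb⟩ := run_hiddenVerifier A u w
  rw [← hb]
  constructor
  · rintro ⟨t, s', h'⟩
    simpa using congrArg Prod.fst (run_unique h h')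
  · rintro rfl
    exact ⟨_, s, h⟩

theorem runsInPolyTime_hiddenVerifier : RunsInPolyTime A hiddenVerifier := by
  refine ⟨8 * Polynomial.X + 10, fun u w => ?_⟩
  obtain ⟨b, s, h, -⟩ := run_hiddenVerifier A u w
  rw [run_mono h (t' := (8 * Polynomial.X + 10 : Polynomial ℕ).eval (u.length + w.length))]
  · rfl
  · simp

end HiddenVerifier

/-! ### The language of the hidden first bits -/

/-- The strings of `L` of a length at which the hidden string begins with `true`. -/
def hiddenLanguage (x : (n : ℕ) → Fin n → Bool) (L : Language Bool) : Language Bool :=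
  {u | u ∈ L ∧ (List.ofFn (x u.length)).head? = some true}

theorem mem_hiddenLanguage {x : (n : ℕ) → Fin n → Bool} {L : Language Bool} {u : List Bool} :
    u ∈ hiddenLanguage x L ↔ u ∈ L ∧ (List.ofFn (x u.length)).head? = some true := Iff.rfl

theorem BoolOracle.answer_eq_true_iff (f : BoolOracle) (s : List Bool) :
    f.answer s = true ↔
      ∃ (n : ℕ) (z y : Fin n → Bool), s = List.ofFn z ++ List.ofFn y ∧ f n z y = true := by
  simp only [BoolOracle.answer, decide_eq_true_eq]

/-- A string has only one decomposition into two halves of equal length, so the existential in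
`answer` can only mean `w` and `u`. -/
theorem answer_hiddenBit (x : (n : ℕ) → Fin n → Bool) (L : Language Bool) {u w : List Bool}
    (h : w.length = u.length) :
    (hiddenBit x L).answer (w ++ u) = true ↔ w = List.ofFn (x u.length) ∧ u ∈ L := by
  simp only [BoolOracle.answer_eq_true_iff, hiddenBit, decide_eq_true_eq]
  constructor
  · rintro ⟨n, z, y, hs, rfl, hy⟩
    have hn : u.length = n := by
      have := congrArg List.length hs
      simp at this
      omega
    obtain ⟨rfl, rfl⟩ := List.append_inj hs (by simp [h, hn])
    rw [hn]
    exact ⟨rfl, hy⟩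
  · rintro ⟨rfl, hu⟩
    exact ⟨u.length, x u.length, u.get, by simp, rfl, by simpa using hu⟩

/-- The hidden string is the only second argument that can be accepted, and it depends only on the
input length. The same program therefore serves for NP and for P/poly. -/
theorem accepts_hiddenVerifier_hiddenBit (x : (n : ℕ) → Fin n → Bool) (L : Language Bool)
    (u w : List Bool) :
    Accepts (hiddenBit x L).answer hiddenVerifier u w ↔
      w = List.ofFn (x u.length) ∧ u ∈ hiddenLanguage x L := by
  rw [accepts_hiddenVerifier, mem_hiddenLanguage]
  constructor
  · rintro ⟨hl, hA, hh⟩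
    obtain ⟨rfl, hu⟩ := (answer_hiddenBit x L hl).1 hA
    refine ⟨rfl, hu, ?_⟩
    -- The program reads the first bit of `w ++ u`, which is the first bit of `w` unless both
    -- strings are empty; in that case there is no first bit and it rejects.
    rcases hw : List.ofFn (x u.length) with _ | ⟨b, r⟩
    · have : u = [] := by simpa [hw] using hl.symm
      simp [this] at hh
    · simpa [hw] using hh
  · rintro ⟨rfl, hu, hh⟩
    have hl : (List.ofFn (x u.length)).length = u.length := by simp
    refine ⟨hl, (answer_hiddenBit x L hl).2 ⟨rfl, hu⟩, ?_⟩
    rw [List.head?_append, hh]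
    rfl

theorem hiddenLanguage_mem_NP (x : (n : ℕ) → Fin n → Bool) (L : Language Bool) :
    hiddenLanguage x L ∈ NP (hiddenBit x L) := by
  refine ⟨hiddenVerifier, Polynomial.X, runsInPolyTime_hiddenVerifier, fun u => ?_⟩
  simp only [accepts_hiddenVerifier_hiddenBit]
  constructor
  · intro hu
    exact ⟨_, by simp, rfl, hu⟩
  · rintro ⟨w, -, -, hu⟩
    exact hu

theorem hiddenLanguage_mem_PPoly (x : (n : ℕ) → Fin n → Bool) (L : Language Bool) :
    hiddenLanguage x L ∈ PPoly (hiddenBit x L) := by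
  refine ⟨hiddenVerifier, Polynomial.X, fun n => List.ofFn (x n), runsInPolyTime_hiddenVerifier,
    by simp, fun u => ?_⟩
  simp [accepts_hiddenVerifier_hiddenBit]

/-! ### Square norms of state vectors -/

/-- The square of the Euclidean norm. -/
noncomputable def sqNorm {ι : Type*} [Fintype ι] (ψ : ι → ℂ) : ℝ := ∑ i, ‖ψ i‖ ^ 2

section SqNorm

variable {ι κ : Type*} [Fintype ι] [Fintype κ]

theorem sqNorm_nonneg (ψ : ι → ℂ) : 0 ≤ sqNorm ψ := by
  unfold sqNorm
  positivity

@[simp] theorem sqNorm_zero : sqNorm (0 : ι → ℂ) = 0 := by simp [sqNorm]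

/-- The norm instance on `ι → ℂ` is the supremum norm, so the triangle inequality has to be imported
from `EuclideanSpace`. -/
theorem sqNorm_eq_norm_sq (ψ : ι → ℂ) :
    sqNorm ψ = ‖(WithLp.toLp 2 ψ : EuclideanSpace ℂ ι)‖ ^ 2 := by
  rw [EuclideanSpace.norm_sq_eq]
  rfl

theorem sqNorm_add_le {f g : ι → ℂ} {a b : ℝ} (ha : 0 ≤ a) (hb : 0 ≤ b) (hf : sqNorm f ≤ a ^ 2)
    (hg : sqNorm g ≤ b ^ 2) : sqNorm (f + g) ≤ (a + b) ^ 2 := by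
  rw [sqNorm_eq_norm_sq] at *
  have hf := (sq_le_sq₀ (norm_nonneg _) ha).1 hf
  have hg := (sq_le_sq₀ (norm_nonneg _) hb).1 hg
  have h := norm_add_le (WithLp.toLp 2 f : EuclideanSpace ℂ ι) (WithLp.toLp 2 g)
  rw [WithLp.toLp_add]
  gcongr
  linarith

theorem sum_sqNorm (ψ : κ → ι → ℂ) : ∑ k, sqNorm (ψ k) = sqNorm fun p : κ × ι => ψ p.1 p.2 := by
  simp [sqNorm, Fintype.sum_prod_type]

/-- A family of vectors is one vector on `κ × ι`, so this is again the triangle inequality. It lets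
the hybrid argument treat all hidden strings simultaneously. -/
theorem sum_sqNorm_add_le {f g : κ → ι → ℂ} {a b : ℝ} (ha : 0 ≤ a) (hb : 0 ≤ b)
    (hf : ∑ k, sqNorm (f k) ≤ a ^ 2) (hg : ∑ k, sqNorm (g k) ≤ b ^ 2) :
    ∑ k, sqNorm (f k + g k) ≤ (a + b) ^ 2 := by
  rw [sum_sqNorm] at *
  exact sqNorm_add_le ha hb hf hg

theorem sqNorm_comp_equiv (e : κ ≃ ι) (ψ : ι → ℂ) : (sqNorm fun k => ψ (e k)) = sqNorm ψ :=
  e.sum_comp fun i => ‖ψ i‖ ^ 2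

theorem sqNorm_mulVec_of_conjTranspose_mul [DecidableEq ι] {M : Matrix ι ι ℂ} (hM : Mᴴ * M = 1)
    (ψ : ι → ℂ) : sqNorm (M *ᵥ ψ) = sqNorm ψ := by
  have key : ∀ φ : ι → ℂ, ((sqNorm φ : ℝ) : ℂ) = star φ ⬝ᵥ φ := by
    intro φ
    simp [sqNorm, dotProduct, Complex.conj_mul']
  apply Complex.ofReal_injective
  rw [key, key, star_mulVec, dotProduct_mulVec, vecMul_vecMul, hM, vecMul_one]

/-- Both sums are squared norms of projections. With norms `a, b ≤ 1` of the projections, `|a² - b²|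
= (a + b) |a - b| ≤ 2d`. -/
theorem abs_partial_sqNorm_sub_le (s : ι → Prop) [DecidablePred s] {f g : ι → ℂ} {d : ℝ}
    (hd : 0 ≤ d) (hf : sqNorm f ≤ 1) (hg : sqNorm g ≤ 1) (hfg : sqNorm (f - g) ≤ d ^ 2) :
    |(∑ i, if s i then ‖f i‖ ^ 2 else 0) - ∑ i, if s i then ‖g i‖ ^ 2 else 0| ≤ 2 * d := by
  let cut : (ι → ℂ) → ι → ℂ := fun h i => if s i then h i else 0
  have hcut : ∀ h : ι → ℂ, (∑ i, if s i then ‖h i‖ ^ 2 else 0) = sqNorm (cut h) := by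
    intro h
    refine Finset.sum_congr rfl fun i _ => ?_
    by_cases hi : s i <;> simp [cut, hi]
  have hle : ∀ h : ι → ℂ, sqNorm (cut h) ≤ sqNorm h := by
    intro h
    refine Finset.sum_le_sum fun i _ => ?_
    by_cases hi : s i <;> simp [cut, hi]
  have hsub : cut f - cut g = cut (f - g) := by
    funext i
    by_cases hi : s i <;> simp [cut, hi]
  rw [hcut, hcut]
  have h₁ := (hle f).trans hf
  have h₂ := (hle g).trans hg
  have h₃ := (hle (f - g)).trans hfg
  rw [← hsub] at h₃
  rw [sqNorm_eq_norm_sq] at h₁ h₂ h₃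
  rw [sqNorm_eq_norm_sq, sqNorm_eq_norm_sq]
  have h₁ := (sq_le_one_iff₀ (norm_nonneg _)).1 h₁
  have h₂ := (sq_le_one_iff₀ (norm_nonneg _)).1 h₂
  have h₃ := (sq_le_sq₀ (norm_nonneg _) hd).1 h₃
  rw [WithLp.toLp_sub] at h₃
  have h₄ := (abs_norm_sub_norm_le _ _).trans h₃
  rw [sq_sub_sq, abs_mul, abs_of_nonneg (by positivity)]
  gcongr
  linarith

end SqNorm

/-! ### Operators on some of the qubits -/

/-- The action of a matrix on the qubits listed by `q`. -/
noncomputable def liftAct {W V : Type*} [Fintype W] [DecidableEq W]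
    (M : Matrix (W → Bool) (W → Bool) ℂ) (q : W ↪ V) (ψ : (V → Bool) → ℂ) : (V → Bool) → ℂ :=
  fun b => ∑ a, M (fun j => b (q j)) a * ψ (Function.extend q a b)

section LiftAct

variable {W V : Type*} (q : W ↪ V)

theorem extend_embedding_apply (a : W → Bool) (b : V → Bool) :
    (fun j => Function.extend q a b (q j)) = a :=
  funext fun j => q.injective.extend_apply a b j

theorem extend_embedding_extend (a a' : W → Bool) (b : V → Bool) :
    Function.extend q a' (Function.extend q a b) = Function.extend q a' b := by
  funext v
  by_cases hv : ∃ j, q j = v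
  · obtain ⟨j, rfl⟩ := hv
    simp [q.injective.extend_apply]
  · simp [Function.extend_apply' _ _ _ hv]

theorem extend_embedding_self (b : V → Bool) : Function.extend q (fun j => b (q j)) b = b := by
  funext v
  by_cases hv : ∃ j, q j = v
  · obtain ⟨j, rfl⟩ := hv
    simp [q.injective.extend_apply]
  · simp [Function.extend_apply' _ _ _ hv]

theorem extend_embedding_update [DecidableEq W] [DecidableEq V] (b : V → Bool) (j : W) (c : Bool) :
    Function.extend q (Function.update (fun k => b (q k)) j c) b = Function.update b (q j) c := by
  funext v
  by_cases hv : ∃ k, q k = v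
  · obtain ⟨k, rfl⟩ := hv
    rw [q.injective.extend_apply]
    by_cases hk : k = j
    · subst hk; simp
    · simp [hk]
  · rw [Function.extend_apply' _ _ _ hv, Function.update_of_ne]
    rintro rfl
    exact hv ⟨j, rfl⟩

/-- Exchange of the values on the qubits listed by `q` with a second assignment. -/
noncomputable def exchangeEquiv : (W → Bool) × (V → Bool) ≃ (W → Bool) × (V → Bool) :=
  Function.Involutive.toPerm (fun p => (fun j => p.2 (q j), Function.extend q p.1 p.2)) <| by
    rintro ⟨a, b⟩
    simp only [extend_embedding_apply, extend_embedding_extend, extend_embedding_self]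

variable [Fintype W] [DecidableEq W]

theorem liftAct_extend (M : Matrix (W → Bool) (W → Bool) ℂ) (ψ : (V → Bool) → ℂ) (b : V → Bool)
    (a : W → Bool) :
    liftAct M q ψ (Function.extend q a b) = (M *ᵥ fun a' => ψ (Function.extend q a' b)) a := by
  simp [liftAct, mulVec, dotProduct, extend_embedding_apply, extend_embedding_extend]

theorem liftAct_apply (M : Matrix (W → Bool) (W → Bool) ℂ) (ψ : (V → Bool) → ℂ) (b : V → Bool) :
    liftAct M q ψ b = (M *ᵥ fun a' => ψ (Function.extend q a' b)) fun j => b (q j) := rfl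

theorem liftAct_mul (M N : Matrix (W → Bool) (W → Bool) ℂ) (ψ : (V → Bool) → ℂ) :
    liftAct (M * N) q ψ = liftAct M q (liftAct N q ψ) := by
  funext b
  rw [liftAct_apply, liftAct_apply, ← mulVec_mulVec]
  simp only [liftAct_extend]

theorem liftAct_one (ψ : (V → Bool) → ℂ) : liftAct 1 q ψ = ψ := by
  funext b
  rw [liftAct_apply, one_mulVec, extend_embedding_self]

theorem liftAct_sub_left (M N : Matrix (W → Bool) (W → Bool) ℂ) (ψ : (V → Bool) → ℂ) :
    liftAct (M - N) q ψ = liftAct M q ψ - liftAct N q ψ := by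
  funext b
  simp [liftAct, sub_mul]

theorem liftAct_sub (M : Matrix (W → Bool) (W → Bool) ℂ) (ψ φ : (V → Bool) → ℂ) :
    liftAct M q (ψ - φ) = liftAct M q ψ - liftAct M q φ := by
  funext b
  simp [liftAct, mul_sub]

variable [Fintype V] [DecidableEq V]

/-- Double counting through `exchangeEquiv`: as `a` and `b` vary, each basis state arises from the
same number of pairs. This replaces a splitting of the qubits into the range of `q` and its
complement. -/
theorem card_mul_sqNorm (ψ : (V → Bool) → ℂ) :
    (Fintype.card (W → Bool) : ℝ) * sqNorm ψ =
      ∑ b, sqNorm fun a => ψ (Function.extend q a b) := by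
  have h := (exchangeEquiv q).sum_comp fun p => ‖ψ p.2‖ ^ 2
  rw [Fintype.sum_prod_type, Fintype.sum_prod_type, Finset.sum_comm] at h
  simp only [sqNorm, Finset.sum_const, Finset.card_univ, nsmul_eq_mul] at h ⊢
  exact h.symm

/-- On each slice, where the qubits outside `q` are frozen, the lifted operator is `M z` itself; the
slice bounds add up and the common multiplicity cancels. -/
theorem sum_sqNorm_liftAct_le {Z : Type*} [Fintype Z] {M : Z → Matrix (W → Bool) (W → Bool) ℂ}
    {c : ℝ} (hM : ∀ φ, ∑ z, sqNorm (M z *ᵥ φ) ≤ c * sqNorm φ) (ψ : (V → Bool) → ℂ) :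
    ∑ z, sqNorm (liftAct (M z) q ψ) ≤ c * sqNorm ψ := by
  have hpos : (0 : ℝ) < Fintype.card (W → Bool) := by exact_mod_cast Fintype.card_pos
  refine le_of_mul_le_mul_left ?_ hpos
  rw [Finset.mul_sum, mul_left_comm, card_mul_sqNorm q, Finset.mul_sum]
  simp only [card_mul_sqNorm q, liftAct_extend]
  rw [Finset.sum_comm]
  exact Finset.sum_le_sum fun b _ => hM _

theorem sqNorm_liftAct_le {M : Matrix (W → Bool) (W → Bool) ℂ}
    (hM : ∀ φ, sqNorm (M *ᵥ φ) ≤ sqNorm φ) (ψ : (V → Bool) → ℂ) :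
    sqNorm (liftAct M q ψ) ≤ sqNorm ψ := by
  simpa using sum_sqNorm_liftAct_le (Z := Unit) (M := fun _ => M) (c := 1) q (by simpa using hM) ψ

end LiftAct

/-! ### Tensor products of one-qubit operators -/

/-- The tensor product of one-qubit operators. -/
def tensorMatrix {W : Type*} [Fintype W] (m : W → Matrix Bool Bool ℂ) :
    Matrix (W → Bool) (W → Bool) ℂ :=
  Matrix.of fun out inp => ∏ k, m k (out k) (inp k)

/-- The one-qubit Hadamard matrix. -/
noncomputable def hadamardMatrix : Matrix Bool Bool ℂ :=
  Matrix.of fun out inp => (if out && inp then -1 else 1) / (Real.sqrt 2 : ℂ)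

theorem sqrt_two_mul_sqrt_two : (Real.sqrt 2 : ℂ) * (Real.sqrt 2 : ℂ) = 2 := by
  rw [← Complex.ofReal_mul, Real.mul_self_sqrt (by norm_num)]
  norm_num

theorem hadamardMatrix_mul_self : hadamardMatrix * hadamardMatrix = 1 := by
  ext i j
  have h : (Real.sqrt 2 : ℂ)⁻¹ * (Real.sqrt 2 : ℂ)⁻¹ = 1 / 2 := by
    rw [← mul_inv, sqrt_two_mul_sqrt_two, one_div]
  cases i <;> cases j <;>
    simp only [Matrix.mul_apply, hadamardMatrix, Matrix.of_apply, Fintype.sum_bool,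
      div_eq_mul_inv, Bool.and_self, Bool.and_false, Bool.false_and, Bool.false_eq_true, if_true,
      if_false, one_mul, neg_mul, mul_neg, neg_neg, h] <;>
    norm_num

theorem hadamardMatrix_conjTranspose : hadamardMatrixᴴ = hadamardMatrix := by
  ext i j
  cases i <;> cases j <;> simp [hadamardMatrix]

section TensorMatrix

variable {W : Type*} [Fintype W]

theorem tensorMatrix_mul [DecidableEq W] (m m' : W → Matrix Bool Bool ℂ) :
    tensorMatrix m * tensorMatrix m' = tensorMatrix (m * m') := by
  ext i j
  simp only [tensorMatrix, Matrix.mul_apply, Matrix.of_apply, Pi.mul_apply,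
    ← Finset.prod_mul_distrib]
  rw [Finset.prod_univ_sum, Fintype.piFinset_univ]

theorem tensorMatrix_one : tensorMatrix (1 : W → Matrix Bool Bool ℂ) = 1 := by
  ext i j
  by_cases h : i = j
  · subst h
    simp [tensorMatrix]
  · obtain ⟨k, hk⟩ := Function.ne_iff.1 h
    rw [Matrix.one_apply_ne h]
    exact Finset.prod_eq_zero (Finset.mem_univ k) (by simp [hk])

theorem tensorMatrix_conjTranspose (m : W → Matrix Bool Bool ℂ) :
    (tensorMatrix m)ᴴ = tensorMatrix fun k => (m k)ᴴ := by
  ext i j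
  simp [tensorMatrix]

theorem tensorMatrix_mulSingle_mulVec [DecidableEq W] (h : Matrix Bool Bool ℂ) (j : W)
    (g : (W → Bool) → ℂ) (o : W → Bool) :
    (tensorMatrix (Pi.mulSingle j h) *ᵥ g) o =
      h (o j) false * g (Function.update o j false) +
        h (o j) true * g (Function.update o j true) := by
  have hval : ∀ c, tensorMatrix (Pi.mulSingle j h) o (Function.update o j c) = h (o j) c := by
    intro c
    simp only [tensorMatrix, Matrix.of_apply]
    rw [Finset.prod_eq_single j]
    · simp
    · intro k _ hk
      simp [hk]
    · simp
  rw [← hval false, ← hval true]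
  have hne : Function.update o j false ≠ Function.update o j true := by
    intro h
    simpa using congrFun h j
  rw [← Finset.sum_pair (f := fun a => tensorMatrix (Pi.mulSingle j h) o a * g a) hne]
  refine (Finset.sum_subset (Finset.subset_univ _) fun a _ ha => ?_).symm
  obtain ⟨k, hk, hne⟩ : ∃ k, k ≠ j ∧ o k ≠ a k := by
    by_contra! hcon
    apply ha
    have : a = Function.update o j (a j) := by
      funext k
      by_cases hk : k = j
      · subst hk; simp
      · simp [hk, hcon k hk]
    rw [this]
    cases a j <;> simp
  refine mul_eq_zero_of_left (Finset.prod_eq_zero (Finset.mem_univ k) ?_) _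
  simp [hk, hne]

end TensorMatrix

theorem hadamardFst_eq_tensorMatrix (n : ℕ) :
    hadamardFst n = tensorMatrix (Sum.elim (fun _ => hadamardMatrix) 1) := by
  ext o i
  simp only [hadamardFst, tensorMatrix, Matrix.of_apply, Fintype.prod_sum_type, Sum.elim_inl,
    Sum.elim_inr, Pi.one_apply, Finset.univ_unique, Finset.prod_singleton]
  have h₁ : (∏ k : Fin n, (1 : Matrix Bool Bool ℂ) (o (Sum.inr (Sum.inl k)))
      (i (Sum.inr (Sum.inl k)))) = if regSnd o = regSnd i then 1 else 0 := by
    have := congrFun (congrFun (tensorMatrix_one (W := Fin n)) (regSnd o)) (regSnd i)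
    rw [Matrix.one_apply] at this
    exact this
  have h₂ : (1 : Matrix Bool Bool ℂ) (o (Sum.inr (Sum.inr default)))
      (i (Sum.inr (Sum.inr default))) = if regBit o = regBit i then 1 else 0 := Matrix.one_apply
  rw [h₁, h₂]
  by_cases h2 : regSnd o = regSnd i
  · by_cases h3 : regBit o = regBit i
    · rw [if_pos ⟨h2, h3⟩, if_pos h2, if_pos h3, mul_one, mul_one]
      simp [hadamardMatrix, regFst]
    · rw [if_neg (by tauto), if_neg h3]
      simp
  · rw [if_neg (by tauto), if_neg h2]
    simp

theorem hadamardFst_mul_self (n : ℕ) : hadamardFst n * hadamardFst n = 1 := by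
  rw [hadamardFst_eq_tensorMatrix, tensorMatrix_mul, ← tensorMatrix_one]
  congr 1
  funext k
  rcases k with k | k <;> simp [hadamardMatrix_mul_self]

theorem hadamardFst_conjTranspose (n : ℕ) : (hadamardFst n)ᴴ = hadamardFst n := by
  rw [hadamardFst_eq_tensorMatrix, tensorMatrix_conjTranspose]
  congr 1
  funext k
  rcases k with k | k <;> simp [hadamardMatrix_conjTranspose]

theorem sqNorm_hadamardFst_mulVec {n : ℕ} (φ : (OracleWire n → Bool) → ℂ) :
    sqNorm (hadamardFst n *ᵥ φ) = sqNorm φ :=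
  sqNorm_mulVec_of_conjTranspose_mul
    (by rw [hadamardFst_conjTranspose, hadamardFst_mul_self]) φ

/-- Taken with all qubits, this shows that the gate preserves the norm; taken with the wires of an
oracle call, it lets Hadamard gates be multiplied with the oracle matrix. -/
theorem hadamard_act_eq_liftAct (U : QuantumOracle) {N : ℕ} {W : Type*} [Fintype W]
    [DecidableEq W] (q : W ↪ Fin N) (j : W) (ψ : (Fin N → Bool) → ℂ) :
    (Gate.hadamard (q j)).act U ψ =
      liftAct (tensorMatrix (Pi.mulSingle j hadamardMatrix)) q ψ := by
  funext b
  rw [liftAct_apply, tensorMatrix_mulSingle_mulVec, extend_embedding_update,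
    extend_embedding_update]
  simp only [Gate.act, hadamardMatrix, Matrix.of_apply, Bool.and_false, Bool.and_true,
    Bool.false_eq_true, if_false]
  ring

/-! ### The standard oracles as permutations -/

/-- The permutation `|z⟩|y⟩|c⟩ ↦ |z⟩|y⟩|c ⊕ g z y⟩` of basis states. -/
def xorTarget {n : ℕ} (g : (Fin n → Bool) → (Fin n → Bool) → Bool) (o : OracleWire n → Bool) :
    OracleWire n → Bool :=
  Function.update o (Sum.inr (Sum.inr ())) (xor (regBit o) (g (regFst o) (regSnd o)))

section XorTarget

variable {n : ℕ} (g : (Fin n → Bool) → (Fin n → Bool) → Bool) (o : OracleWire n → Bool)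

@[simp] theorem regFst_xorTarget : regFst (xorTarget g o) = regFst o := by
  funext i
  simp [regFst, xorTarget]

@[simp] theorem regSnd_xorTarget : regSnd (xorTarget g o) = regSnd o := by
  funext i
  simp [regSnd, xorTarget]

@[simp] theorem regBit_xorTarget :
    regBit (xorTarget g o) = xor (regBit o) (g (regFst o) (regSnd o)) := by
  simp [regBit, xorTarget]

theorem oracleWire_ext {o o' : OracleWire n → Bool} (h₁ : regFst o = regFst o')
    (h₂ : regSnd o = regSnd o') (h₃ : regBit o = regBit o') : o = o' := by
  funext k
  rcases k with k | k | k
  · exact congrFun h₁ k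
  · exact congrFun h₂ k
  · exact h₃

theorem xorTarget_involutive : Function.Involutive (xorTarget g) := fun o =>
  oracleWire_ext (by simp) (by simp) (by simp)

theorem xorTarget_of_eq_false (h : g (regFst o) (regSnd o) = false) : xorTarget g o = o :=
  oracleWire_ext (by simp) (by simp) (by simp [h])

end XorTarget

theorem toQuantum_mulVec (f : BoolOracle) {n : ℕ} (φ : (OracleWire n → Bool) → ℂ)
    (o : OracleWire n → Bool) : (f.toQuantum n *ᵥ φ) o = φ (xorTarget (f n) o) := by
  simp only [mulVec, dotProduct, BoolOracle.toQuantum, Matrix.of_apply]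
  rw [Finset.sum_eq_single (xorTarget (f n) o)]
  · simp
  · intro i _ hi
    rw [if_neg, zero_mul]
    rintro ⟨h₁, h₂, h₃⟩
    refine hi (oracleWire_ext ?_ ?_ ?_)
    · simp [h₁]
    · simp [h₂]
    · simp [h₁, h₂, h₃]
  · simp

theorem sqNorm_toQuantum_mulVec (f : BoolOracle) {n : ℕ} (φ : (OracleWire n → Bool) → ℂ) :
    sqNorm (f.toQuantum n *ᵥ φ) = sqNorm φ := by
  rw [← sqNorm_comp_equiv ((xorTarget_involutive (f n)).toPerm _) φ]
  congr 1
  funext o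
  exact toQuantum_mulVec f φ o

/-! ### Families of oracles that hide strings -/

/-- A family of oracles parametrized by hidden strings: the `n`-th operator is a contraction
determined by the `n`-th string, and differs from the identity little on average over the
strings. -/
structure HidesStrings (U : ((n : ℕ) → Fin n → Bool) → QuantumOracle) : Prop where
  congr : ∀ x y n, x n = y n → U x n = U y n
  contractive : ∀ x n φ, sqNorm (U x n *ᵥ φ) ≤ sqNorm φ
  sum_sub_one : ∀ x n φ, ∑ z, sqNorm ((U (Function.update x n z) n - 1) *ᵥ φ) ≤ 4 * sqNorm φ

/-- At a basis state `o`, the oracle can differ from the identity only if the hidden string is the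
first register of `o`. The sum over strings thus has at most one nonzero term at each `o`, and `|a -
b|² ≤ 2|a|² + 2|b|²` gives the constant 4. -/
theorem hidesStrings_standardOracle (L : Language Bool) :
    HidesStrings fun x => standardOracle x L where
  congr x y n h := by
    have hbit : hiddenBit x L n = hiddenBit y L n := by
      unfold hiddenBit
      rw [h]
    unfold standardOracle BoolOracle.toQuantum
    rw [hbit]
  contractive x n φ := (sqNorm_toQuantum_mulVec _ φ).le
  sum_sub_one x n φ := by
    let τ : Equiv.Perm (OracleWire n → Bool) :=
      (xorTarget_involutive fun _ _ => true).toPerm _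
    have hbound : ∀ o, ∑ z, ‖((standardOracle (Function.update x n z) L n - 1) *ᵥ φ) o‖ ^ 2 ≤
        2 * ‖φ (τ o)‖ ^ 2 + 2 * ‖φ o‖ ^ 2 := by
      intro o
      have hval : ∀ z, ((standardOracle (Function.update x n z) L n - 1) *ᵥ φ) o =
          φ (xorTarget (hiddenBit (Function.update x n z) L n) o) - φ o := by
        intro z
        rw [sub_mulVec, one_mulVec, Pi.sub_apply]
        congr 1
        exact toQuantum_mulVec _ φ o
      rw [Finset.sum_eq_single (regFst o)]
      · rw [hval]
        rcases hg : hiddenBit (Function.update x n (regFst o)) L n (regFst o) (regSnd o)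
        · rw [xorTarget_of_eq_false _ _ hg, sub_self]
          rw [norm_zero, zero_pow two_ne_zero]
          positivity
        · have : xorTarget (hiddenBit (Function.update x n (regFst o)) L n) o = τ o := by
            refine oracleWire_ext ?_ ?_ ?_ <;>
              simp [τ, hg]
          rw [this]
          have h := norm_sub_le (φ (τ o)) (φ o)
          nlinarith [norm_nonneg (φ (τ o) - φ o), sq_nonneg (‖φ (τ o)‖ - ‖φ o‖)]
      · intro z _ hz
        rw [hval, xorTarget_of_eq_false, sub_self]
        · simp
        · simp [hiddenBit, hz.symm]
      · simp
    calc ∑ z, sqNorm ((standardOracle (Function.update x n z) L n - 1) *ᵥ φ)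
        = ∑ o, ∑ z, ‖((standardOracle (Function.update x n z) L n - 1) *ᵥ φ) o‖ ^ 2 := by
          simp only [sqNorm]
          exact Finset.sum_comm
      _ ≤ ∑ o, (2 * ‖φ (τ o)‖ ^ 2 + 2 * ‖φ o‖ ^ 2) := Finset.sum_le_sum fun o _ => hbound o
      _ = 4 * sqNorm φ := by
          rw [Finset.sum_add_distrib, ← Finset.mul_sum, ← Finset.mul_sum,
            Equiv.sum_comp τ fun o => ‖φ o‖ ^ 2, sqNorm]
          ring

/-- As `H` is a norm-preserving involution, `H O H - 1 = H (O - 1) H`, and the bounds for the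
standard oracle carry over. -/
theorem hidesStrings_hadamardOracle (L : Language Bool) :
    HidesStrings fun x => hadamardOracle x L where
  congr x y n h := by
    have h' : standardOracle x L n = standardOracle y L n :=
      (hidesStrings_standardOracle L).congr x y n h
    simp only [hadamardOracle, QuantumOracle.hadamardConj, h']
  contractive x n φ := by
    simp only [hadamardOracle, QuantumOracle.hadamardConj, ← mulVec_mulVec,
      sqNorm_hadamardFst_mulVec]
    exact ((hidesStrings_standardOracle L).contractive x n _).trans_eq
      (sqNorm_hadamardFst_mulVec φ)
  sum_sub_one x n φ := by
    have h : ∀ z, hadamardOracle (Function.update x n z) L n - 1 =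
        hadamardFst n * (standardOracle (Function.update x n z) L n - 1) * hadamardFst n := by
      intro z
      rw [Matrix.mul_sub, Matrix.sub_mul, Matrix.mul_one, hadamardFst_mul_self]
      rfl
    simp only [h, ← mulVec_mulVec, sqNorm_hadamardFst_mulVec]
    refine ((hidesStrings_standardOracle L).sum_sub_one x n _).trans_eq ?_
    rw [sqNorm_hadamardFst_mulVec]

/-! ### The hybrid argument -/

section Gates

variable {N : ℕ}

theorem Gate.act_sub (U : QuantumOracle) (g : Gate N) (ψ φ : (Fin N → Bool) → ℂ) :
    g.act U (ψ - φ) = g.act U ψ - g.act U φ := by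
  cases g with
  | hadamard i =>
    funext b
    simp only [Gate.act, Pi.sub_apply]
    ring
  | phase i =>
    funext b
    simp only [Gate.act, Pi.sub_apply]
    ring
  | cnot c t h => rfl
  | toffoli c d t _ _ _ => rfl
  | oracle n q => exact liftAct_sub q _ ψ φ

theorem xor_update_involutive (t : Fin N) (e : (Fin N → Bool) → Bool)
    (he : ∀ b c, e (Function.update b t c) = e b) :
    Function.Involutive fun b => Function.update b t (xor (b t) (e b)) := by
  intro b
  simp [he]

theorem Gate.sqNorm_act_le {U : QuantumOracle}
    (hU : ∀ n φ, sqNorm (U n *ᵥ φ) ≤ sqNorm φ) (g : Gate N) (ψ : (Fin N → Bool) → ℂ) :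
    sqNorm (g.act U ψ) ≤ sqNorm ψ := by
  cases g with
  | hadamard i =>
    have h := hadamard_act_eq_liftAct U (Function.Embedding.refl (Fin N)) i ψ
    rw [Function.Embedding.refl_apply] at h
    rw [h]
    refine sqNorm_liftAct_le _ (fun φ => (sqNorm_mulVec_of_conjTranspose_mul ?_ φ).le) ψ
    rw [tensorMatrix_conjTranspose, tensorMatrix_mul, ← tensorMatrix_one]
    congr 1
    funext k
    by_cases hk : k = i
    · subst hk
      simp [hadamardMatrix_conjTranspose, hadamardMatrix_mul_self]
    · simp [hk]
  | phase i =>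
    refine (Finset.sum_congr rfl fun b _ => ?_).le
    simp only [Gate.act, norm_mul]
    have : ‖Complex.exp (Complex.I * Real.pi / 4)‖ = 1 := by
      have := Complex.norm_exp_ofReal_mul_I (Real.pi / 4)
      rw [← this]
      congr 2
      push_cast
      ring
    split_ifs <;> simp [this]
  | cnot c t h =>
    exact (sqNorm_comp_equiv ((xor_update_involutive t (fun b => b c)
      (by simp [h])).toPerm _) ψ).le
  | toffoli c d t _ hct hdt =>
    exact (sqNorm_comp_equiv ((xor_update_involutive t (fun b => b c && b d)
      (by simp [hct, hdt])).toPerm _) ψ).le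
  | oracle n q => exact sqNorm_liftAct_le q (hU n) ψ

theorem sqNorm_foldl_act_le {U : QuantumOracle} (hU : ∀ n φ, sqNorm (U n *ᵥ φ) ≤ sqNorm φ)
    (gs : List (Gate N)) (ψ : (Fin N → Bool) → ℂ) :
    sqNorm (gs.foldl (fun ψ g => g.act U ψ) ψ) ≤ sqNorm ψ := by
  induction gs generalizing ψ with
  | nil => exact le_rfl
  | cons g gs ih => exact (ih _).trans (g.sqNorm_act_le hU ψ)

theorem sum_sqNorm_act_sub_act_le {Z : Type*} [Fintype Z] {U : Z → QuantumOracle}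
    {U₀ : QuantumOracle} {n : ℕ} (hne : ∀ z m, m ≠ n → U z m = U₀ m)
    (hn : ∀ φ, ∑ z, sqNorm ((U z n - U₀ n) *ᵥ φ) ≤ 4 * sqNorm φ) (g : Gate N)
    (ψ : (Fin N → Bool) → ℂ) : ∑ z, sqNorm (g.act (U z) ψ - g.act U₀ ψ) ≤ 4 * sqNorm ψ := by
  have hpos := sqNorm_nonneg ψ
  have hzero : (∀ z, g.act (U z) ψ = g.act U₀ ψ) →
      ∑ z, sqNorm (g.act (U z) ψ - g.act U₀ ψ) ≤ 4 * sqNorm ψ := by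
    intro h
    simp only [h, sub_self, sqNorm_zero, Finset.sum_const_zero]
    positivity
  cases g with
  | oracle m q =>
    by_cases hm : m = n
    · subst hm
      have h : ∀ z, (Gate.oracle m q).act (U z) ψ - (Gate.oracle m q).act U₀ ψ =
          liftAct (U z m - U₀ m) q ψ := fun z => (liftAct_sub_left q _ _ ψ).symm
      simp only [h]
      exact sum_sqNorm_liftAct_le q hn ψ
    · exact hzero fun z => by simp only [Gate.act, hne z m hm]
  | _ => exact hzero fun z => rfl

/-- Each gate contracts the error made so far and adds a new error of `ℓ²` size at most `2 = √4`
over all `z` together. The average bound `hn` applies because the new error is measured on the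
reference state, which does not depend on `z`. -/
theorem sum_sqNorm_foldl_sub_le {Z : Type*} [Fintype Z] {U : Z → QuantumOracle}
    {U₀ : QuantumOracle} {n : ℕ} (hU : ∀ z n φ, sqNorm (U z n *ᵥ φ) ≤ sqNorm φ)
    (hU₀ : ∀ n φ, sqNorm (U₀ n *ᵥ φ) ≤ sqNorm φ) (hne : ∀ z m, m ≠ n → U z m = U₀ m)
    (hn : ∀ φ, ∑ z, sqNorm ((U z n - U₀ n) *ᵥ φ) ≤ 4 * sqNorm φ) (gs : List (Gate N))
    (ψ : Z → (Fin N → Bool) → ℂ) (ψ₀ : (Fin N → Bool) → ℂ) {d : ℝ} (hd : 0 ≤ d)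
    (hψ : ∑ z, sqNorm (ψ z - ψ₀) ≤ d ^ 2) (hψ₀ : sqNorm ψ₀ ≤ 1) :
    ∑ z, sqNorm (gs.foldl (fun ψ g => g.act (U z) ψ) (ψ z) -
      gs.foldl (fun ψ g => g.act U₀ ψ) ψ₀) ≤ (d + 2 * gs.length) ^ 2 := by
  induction gs generalizing ψ ψ₀ d with
  | nil => simpa using hψ
  | cons g gs ih =>
    have hstep : ∑ z, sqNorm (g.act (U z) (ψ z) - g.act U₀ ψ₀) ≤ (d + 2) ^ 2 := by
      have h : ∀ z, g.act (U z) (ψ z) - g.act U₀ ψ₀ =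
          g.act (U z) (ψ z - ψ₀) + (g.act (U z) ψ₀ - g.act U₀ ψ₀) := by
        intro z
        rw [Gate.act_sub]
        abel
      simp only [h]
      refine sum_sqNorm_add_le hd zero_le_two ?_ ?_
      · exact (Finset.sum_le_sum fun z _ => g.sqNorm_act_le (hU z) _).trans hψ
      · refine (sum_sqNorm_act_sub_act_le hne hn g ψ₀).trans ?_
        linarith
    refine (ih (fun z => g.act (U z) (ψ z)) (g.act U₀ ψ₀) (by positivity) hstep
      ((g.sqNorm_act_le hU₀ ψ₀).trans hψ₀)).trans_eq ?_
    rw [List.length_cons]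
    push_cast
    ring

/-- An oracle gate needs `2n + 1` distinct qubits, so a circuit sees only finitely many oracles.
Hence its acceptance probability depends on finitely many hidden strings. -/
theorem foldl_act_congr {U U' : QuantumOracle} (h : ∀ n, 2 * n + 1 ≤ N → U n = U' n)
    (gs : List (Gate N)) (ψ : (Fin N → Bool) → ℂ) :
    gs.foldl (fun ψ g => g.act U ψ) ψ = gs.foldl (fun ψ g => g.act U' ψ) ψ := by
  congr 1
  funext ψ g
  cases g with
  | oracle n q =>
    have hcard : 2 * n + 1 ≤ N := by
      have := Fintype.card_le_of_embedding q
      simp at this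
      omega
    simp only [Gate.act, h n hcard]
  | _ => rfl

end Gates

theorem sqNorm_single {ι : Type*} [Fintype ι] [DecidableEq ι] (i : ι) :
    sqNorm (Pi.single i 1 : ι → ℂ) = 1 := by
  rw [sqNorm, Finset.sum_eq_single i]
  · simp
  · intro j _ hj
    simp [hj]
  · simp

theorem Circuit.acceptProb_congr {U U' : QuantumOracle} (C : Circuit)
    (h : ∀ n, n ≤ C.width → U n = U' n) (u : List Bool) :
    C.acceptProb U u = C.acceptProb U' u := by
  simp only [Circuit.acceptProb, Circuit.finalState]
  rw [foldl_act_congr (U := U) (U' := U') fun n hn => h n (by omega)]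

/-- For few values of the `n`-th hidden string does a circuit distinguish the `n`-th oracle from
the identity. -/
theorem HidesStrings.card_acceptProb_le {U : ((n : ℕ) → Fin n → Bool) → QuantumOracle}
    (hU : HidesStrings U) (C : Circuit) (u : List Bool) (x : (n : ℕ) → Fin n → Bool) (n : ℕ) :
    (Finset.univ.filter fun z : Fin n → Bool =>
      1 / 6 ≤ |C.acceptProb (U (Function.update x n z)) u -
        C.acceptProb (Function.update (U x) n 1) u|).card ≤ 576 * C.gates.length ^ 2 := by
  set U₀ : QuantumOracle := Function.update (U x) n 1 with hU₀def
  have hU₀ : ∀ m φ, sqNorm (U₀ m *ᵥ φ) ≤ sqNorm φ := by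
    intro m φ
    by_cases hm : m = n
    · subst hm; simp [hU₀def]
    · simpa [hU₀def, hm] using hU.contractive x m φ
  have hstart := sqNorm_single (fun i : Fin (C.width + 1) => u.getD i false)
  have hsum := sum_sqNorm_foldl_sub_le (U := fun z => U (Function.update x n z)) (U₀ := U₀)
    (n := n) (fun z => hU.contractive _) hU₀
    (fun z m hm => by
      rw [hU₀def, Function.update_of_ne hm]
      exact hU.congr _ _ m (Function.update_of_ne hm _ _))
    (fun φ => by
      rw [hU₀def, Function.update_self]
      exact hU.sum_sub_one x n φ)
    C.gates (fun _ => Pi.single (fun i => u.getD i false) 1)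
    (Pi.single (fun i => u.getD i false) 1) le_rfl (by simp) hstart.le
  rw [zero_add] at hsum
  -- A gap of 1/6 in probability forces a distance of at least 1/12 between the final states. Since
  -- the squared distances sum to at most `(2T)²`, there are at most `144 · 4 T²` such `z`.
  have hbad : ∀ z ∈ Finset.univ.filter (fun z : Fin n → Bool =>
      1 / 6 ≤ |C.acceptProb (U (Function.update x n z)) u - C.acceptProb U₀ u|),
      (1 / 144 : ℝ) ≤ sqNorm (C.finalState (U (Function.update x n z)) u - C.finalState U₀ u) := by
    intro z hz
    have hz := (Finset.mem_filter.1 hz).2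
    have h := abs_partial_sqNorm_sub_le (fun b : Fin (C.width + 1) → Bool => b (Fin.last C.width))
      (Real.sqrt_nonneg _)
      ((sqNorm_foldl_act_le (hU.contractive (Function.update x n z)) C.gates _).trans hstart.le)
      ((sqNorm_foldl_act_le hU₀ C.gates _).trans hstart.le)
      (Real.sq_sqrt (sqNorm_nonneg _)).ge
    have h₁ := hz.trans h
    have h₂ := Real.sq_sqrt (sqNorm_nonneg
      (C.finalState (U (Function.update x n z)) u - C.finalState U₀ u))
    rw [← h₂]
    have h₃ : (1 / 12 : ℝ) ≤
        √(sqNorm (C.finalState (U (Function.update x n z)) u - C.finalState U₀ u)) := by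
      unfold Circuit.finalState
      linarith
    nlinarith
  have h := (Finset.card_nsmul_le_sum _ _ _ hbad).trans
    ((Finset.sum_le_univ_sum_of_nonneg fun z => sqNorm_nonneg _).trans hsum)
  rw [nsmul_eq_mul] at h
  have h' : ((Finset.univ.filter fun z : Fin n → Bool =>
      1 / 6 ≤ |C.acceptProb (U (Function.update x n z)) u - C.acceptProb U₀ u|).card : ℝ) ≤
      576 * C.gates.length ^ 2 := by
    linarith
  exact_mod_cast h'

/-! ### Independence of the hidden strings -/

theorem map_uniformOfFintype_toMeasure {α : Type*} [Fintype α] [Nonempty α] [MeasurableSpace α]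
    [MeasurableSingletonClass α] {f : α → α} (hf : Function.Involutive f) :
    (PMF.uniformOfFintype α).toMeasure.map f = (PMF.uniformOfFintype α).toMeasure := by
  classical
  rw [PMF.toMeasure_map _ _ (measurable_of_countable f)]
  congr 1
  ext a
  rw [PMF.map_apply, tsum_eq_single (f a)]
  · simp [hf a]
  · intro b hb
    rw [if_neg]
    rintro rfl
    exact hb (hf b).symm

/-- Addition of `s` to the `n`-th hidden string. -/
def shiftString (n : ℕ) (s : Fin n → Bool) (x : (m : ℕ) → Fin m → Bool) : (m : ℕ) → Fin m → Bool :=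
  Function.update x n fun j => xor (x n j) (s j)

theorem measurePreserving_shiftString (n : ℕ) (s : Fin n → Bool) :
    MeasurePreserving (shiftString n s) hiddenLaw hiddenLaw := by
  let f : (m : ℕ) → (Fin m → Bool) → Fin m → Bool :=
    Function.update (fun _ => id) n fun z j => xor (z j) (s j)
  have hf : ∀ m, Measurable (f m) := fun m => measurable_of_countable _
  have hshift : shiftString n s = fun x m => f m (x m) := by
    funext x m
    by_cases hm : m = n
    · subst hm; simp [shiftString, f]
    · simp [shiftString, f, hm]
  refine ⟨?_, ?_⟩
  · rw [hshift]
    exact measurable_pi_lambda _ fun m => (hf m).comp (measurable_pi_apply m)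
  · rw [hshift, hiddenLaw, Measure.infinitePi_map_pi _ hf]
    congr 1
    funext m
    apply map_uniformOfFintype_toMeasure
    by_cases hm : m = n
    · subst hm
      intro z
      simp [f]
    · intro z
      simp [f, hm]

/-- Such a set is the preimage of a subset of a finite space under the projection to the first `N`
strings. -/
theorem measurableSet_of_dependsOn {S : Set ((n : ℕ) → Fin n → Bool)} {N : ℕ}
    (hS : DependsOn (fun x => x ∈ S) (Set.Iio N)) : MeasurableSet S := by
  let π : ((n : ℕ) → Fin n → Bool) → (m : Fin N) → Fin m → Bool := fun x m => x m
  have hπ : Measurable π := measurable_pi_lambda _ fun m => measurable_pi_apply _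
  have : S = π ⁻¹' (π '' S) := by
    refine Set.Subset.antisymm (Set.subset_preimage_image π S) ?_
    rintro x ⟨y, hy, hxy⟩
    have h : (y ∈ S) = (x ∈ S) := hS fun m hm => congrFun hxy ⟨m, hm⟩
    exact h ▸ hy
  rw [this]
  exact hπ (Set.toFinite _).measurableSet

/-- `E` may involve the strings that `A` involves, so the two need not be independent. Instead, the
`n`-th string is averaged over all its shifts, which preserve the law and the set `A`: `2^n μ(A ∩
E)` is the integral over `A` of the number of shifts that lead into `E`. -/
theorem hiddenLaw_inter_le {A E : Set ((n : ℕ) → Fin n → Bool)} (hA : MeasurableSet A)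
    (hE : MeasurableSet E) (n : ℕ) (hAn : ∀ x z, Function.update x n z ∈ A ↔ x ∈ A)
    (hEn : ∀ x, 4 * {z | Function.update x n z ∈ E}.ncard ≤ 3 * 2 ^ n) :
    hiddenLaw (A ∩ E) ≤ 3 / 4 * hiddenLaw A := by
  classical
  have hmeas : ∀ s, MeasurableSet (shiftString n s ⁻¹' E) := fun s =>
    (measurePreserving_shiftString n s).measurable hE
  have hs : ∀ s, hiddenLaw (A ∩ E) = hiddenLaw (A ∩ shiftString n s ⁻¹' E) := by
    intro s
    rw [← (measurePreserving_shiftString n s).measure_preimage (hA.inter hE).nullMeasurableSet,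
      Set.preimage_inter]
    congr 2
    ext x
    exact hAn x _
  have hcount : ∀ x, 4 * (Finset.univ.filter fun s => shiftString n s x ∈ E).card ≤ 3 * 2 ^ n := by
    intro x
    refine le_of_eq_of_le ?_ (hEn x)
    rw [← Set.ncard_coe_finset]
    congr 1
    refine Set.ncard_congr (fun s _ j => xor (x n j) (s j)) ?_ ?_ ?_
    · intro s hs
      exact (Finset.mem_filter.1 (Finset.mem_coe.1 hs)).2
    · intro s s' _ _ h
      funext j
      have := congrFun h j
      simpa using this
    · intro z hz
      refine ⟨fun j => xor (x n j) (z j), ?_, ?_⟩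
      · refine Finset.mem_coe.2 (Finset.mem_filter.2 ⟨Finset.mem_univ _, ?_⟩)
        simpa [shiftString] using hz
      · simp
  have hsum : (2 : ENNReal) ^ n * hiddenLaw (A ∩ E) =
      ∫⁻ x in A, ((Finset.univ.filter fun s => shiftString n s x ∈ E).card : ENNReal)
        ∂hiddenLaw := by
    calc (2 : ENNReal) ^ n * hiddenLaw (A ∩ E)
        = ∑ s : Fin n → Bool, hiddenLaw (A ∩ shiftString n s ⁻¹' E) := by
          rw [← Finset.sum_congr rfl fun s _ => hs s]
          simp
      _ = ∑ s : Fin n → Bool, ∫⁻ x in A, (shiftString n s ⁻¹' E).indicator 1 x ∂hiddenLaw := by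
          refine Finset.sum_congr rfl fun s _ => ?_
          rw [lintegral_indicator_one (hmeas s), Measure.restrict_apply (hmeas s), Set.inter_comm]
      _ = ∫⁻ x in A, ∑ s : Fin n → Bool, (shiftString n s ⁻¹' E).indicator 1 x ∂hiddenLaw :=
          (lintegral_finsetSum _ fun s _ => measurable_one.indicator (hmeas s)).symm
      _ = _ := by
          refine lintegral_congr fun x => ?_
          rw [Finset.card_filter]
          push_cast
          exact Finset.sum_congr rfl fun s _ => by simp [Set.indicator_apply]
  have hbound : (2 : ENNReal) ^ n * hiddenLaw (A ∩ E) ≤ 2 ^ n * (3 / 4 * hiddenLaw A) := by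
    rw [hsum]
    calc ∫⁻ x in A, ((Finset.univ.filter fun s => shiftString n s x ∈ E).card : ENNReal) ∂hiddenLaw
        ≤ ∫⁻ _ in A, 3 / 4 * 2 ^ n ∂hiddenLaw := by
          refine lintegral_mono fun x => ?_
          rw [← ENNReal.mul_div_right_comm, ENNReal.le_div_iff_mul_le (by simp) (by simp), mul_comm]
          exact_mod_cast hcount x
      _ = 2 ^ n * (3 / 4 * hiddenLaw A) := by
          rw [setLIntegral_const]
          ring
  exact (ENNReal.mul_le_mul_iff_right (by simp) (by simp)).1 hbound

/-- A set is null if it lies in sets determined by finitely many hidden strings that hold, for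
arbitrarily large `n`, at most three quarters of the values of the `n`-th string, whatever the
others are. -/
theorem hiddenLaw_eq_zero {T : Set ((n : ℕ) → Fin n → Bool)}
    (hT : ∀ N, ∃ n ≥ N, ∃ R, ∃ E, T ⊆ E ∧ DependsOn (fun x => x ∈ E) (Set.Iio R) ∧
      ∀ x, 4 * {z | Function.update x n z ∈ E}.ncard ≤ 3 * 2 ^ n) : hiddenLaw T = 0 := by
  have key : ∀ k : ℕ, ∃ N A, T ⊆ A ∧ DependsOn (fun x => x ∈ A) (Set.Iio N) ∧
      hiddenLaw A ≤ (3 / 4) ^ k := by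
    intro k
    induction k with
    | zero => exact ⟨0, Set.univ, Set.subset_univ _, fun _ _ _ => rfl, by simp⟩
    | succ k ih =>
      obtain ⟨N, A, hTA, hA, hμ⟩ := ih
      -- Since `A` depends only on strings of index less than `N`, the choice `n ≥ N` leaves it
      -- unchanged when the `n`-th string varies. The set `E` may reach beyond `n`, so the next
      -- bound is `max N R`.
      obtain ⟨n, hn, R, E, hTE, hE, hEn⟩ := hT N
      refine ⟨max N R, A ∩ E, Set.subset_inter hTA hTE, ?_, ?_⟩
      · intro x y hxy
        have h₁ : (x ∈ A) = (y ∈ A) := hA fun m hm => hxy m (lt_max_of_lt_left (Set.mem_Iio.1 hm))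
        have h₂ : (x ∈ E) = (y ∈ E) := hE fun m hm => hxy m (lt_max_of_lt_right (Set.mem_Iio.1 hm))
        simp only [Set.mem_inter_iff, h₁, h₂]
      · refine (hiddenLaw_inter_le (measurableSet_of_dependsOn hA) (measurableSet_of_dependsOn hE)
          n (fun x z => ?_) hEn).trans ?_
        · have h : (Function.update x n z ∈ A) = (x ∈ A) :=
            hA fun m hm => Function.update_of_ne (by simp at hm; omega) _ _
          rw [h]
        · rw [pow_succ']
          gcongr
  have hlim : Filter.Tendsto (fun k : ℕ => (3 / 4 : ENNReal) ^ k) Filter.atTop (nhds 0) := by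
    refine ENNReal.tendsto_pow_atTop_nhds_zero_of_lt_one ?_
    rw [ENNReal.div_lt_iff (by simp) (by simp)]
    norm_num
  refine le_antisymm (ge_of_tendsto' hlim fun k => ?_) zero_le
  obtain ⟨N, A, hTA, -, hμ⟩ := key k
  exact (measure_mono hTA).trans hμ

/-! ### Countability of the uniform circuit families -/

theorem replicate_true_append_inj {k k' : ℕ} {r r' : List Bool}
    (h : List.replicate k true ++ false :: r = List.replicate k' true ++ false :: r') :
    k = k' ∧ r = r' := by
  induction k generalizing k' with
  | zero =>
    cases k' with
    | zero => simpa using h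
    | succ k' => simp [List.replicate_succ] at h
  | succ k ih =>
    cases k' with
    | zero => simp [List.replicate_succ] at h
    | succ k' =>
      simp only [List.replicate_succ, List.cons_append, List.cons.injEq, true_and] at h
      simpa using ih h

theorem unary_flatMap_injective :
    Function.Injective fun l : List ℕ => l.flatMap fun k => List.replicate k true ++ [false] := by
  intro l l' h
  induction l generalizing l' with
  | nil =>
    cases l' with
    | nil => rfl
    | cons k' l' => simp at h
  | cons k l ih =>
    cases l' with
    | nil => simp at h
    | cons k' l' =>
      simp only [List.flatMap_cons, List.append_assoc, List.singleton_append] at h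
      obtain ⟨rfl, hr⟩ := replicate_true_append_inj h
      rw [@ih l' hr]

/-- The data are self-delimiting: the opcode, for an oracle call together with `n`, determines how
many numbers follow. -/
theorem Gate.data_append_inj {N : ℕ} {g g' : Gate N} {r r' : List ℕ}
    (h : g.data ++ r = g'.data ++ r') : g = g' ∧ r = r' := by
  cases g <;> cases g' <;>
    simp only [Gate.data, List.cons_append, List.nil_append, List.append_assoc, List.cons.injEq,
      OfNat.ofNat_ne_zero, OfNat.zero_ne_ofNat, OfNat.ofNat_ne_one,
      OfNat.one_ne_ofNat, zero_ne_one, one_ne_zero, false_and, true_and, Nat.reduceEqDiff,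
      Fin.val_inj] at h
  case hadamard.hadamard => simpa using h
  case phase.phase => simpa using h
  case cnot.cnot => simpa [and_assoc] using h
  case toffoli.toffoli => simpa [and_assoc] using h
  case oracle.oracle n q n' q' =>
    obtain ⟨rfl, h⟩ := h
    obtain ⟨h₁, h⟩ := List.append_inj h (by simp)
    obtain ⟨h₂, h⟩ := List.append_inj h (by simp)
    have h₁ := List.ofFn_injective h₁
    have h₂ := List.ofFn_injective h₂
    simp only [List.cons.injEq, Fin.val_inj] at h
    refine ⟨?_, h.2⟩
    congr 1
    ext k
    rcases k with k | k | k
    · exact congrFun h₁ k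
    · exact congrFun h₂ k
    · rw [h.1]

theorem Gate.data_ne_nil {N : ℕ} (g : Gate N) : g.data ≠ [] := by
  cases g <;> simp [Gate.data]

theorem Gate.flatMap_data_injective {N : ℕ} :
    Function.Injective fun gs : List (Gate N) => gs.flatMap Gate.data := by
  intro l l' h
  induction l generalizing l' with
  | nil =>
    cases l' with
    | nil => rfl
    | cons g' l' => simp [Gate.data_ne_nil] at h
  | cons g l ih =>
    cases l' with
    | nil => simp [Gate.data_ne_nil] at h
    | cons g' l' =>
      simp only [List.flatMap_cons] at h
      obtain ⟨rfl, hr⟩ := Gate.data_append_inj h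
      rw [@ih l' hr]

theorem Circuit.code_injective : Function.Injective Circuit.code := by
  rintro ⟨N, gs⟩ ⟨N', gs'⟩ h
  have h := unary_flatMap_injective h
  simp only [List.cons.injEq] at h
  obtain ⟨rfl, h⟩ := h
  rw [Gate.flatMap_data_injective h]

theorem Circuit.length_gates_le (C : Circuit) : C.gates.length ≤ C.code.length := by
  have h₁ : ∀ l : List ℕ,
      l.length ≤ (l.flatMap fun k => List.replicate k true ++ [false]).length := by
    intro l
    induction l with
    | nil => simp
    | cons k l ih =>
      simp only [List.flatMap_cons, List.length_append, List.length_cons, List.length_nil]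
      omega
  have h₂ : ∀ gs : List (Gate (C.width + 1)), gs.length ≤ (gs.flatMap Gate.data).length := by
    intro gs
    induction gs with
    | nil => simp
    | cons g gs ih =>
      have := List.length_pos_iff.2 g.data_ne_nil
      simp only [List.flatMap_cons, List.length_append, List.length_cons]
      omega
  refine (h₂ _).trans (le_trans ?_ (h₁ _))
  simp

/-- An injective encoding of instructions. -/
def Instr.toNatList : Instr → List ℕ
  | push k b n => [0, k, b.toNat, n]
  | pop k e f g => [1, k, e, f, g]
  | query k f g => [2, k, f, g]
  | halt b => [3, b.toNat]

theorem Instr.toNatList_injective : Function.Injective Instr.toNatList := by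
  have hb : ∀ b b' : Bool, b.toNat = b'.toNat → b = b' := by decide
  intro i i' h
  cases i <;> cases i' <;> simp [Instr.toNatList] at h ⊢
  · exact ⟨h.1, hb _ _ h.2.1, h.2.2⟩
  · exact h
  · exact h
  · exact hb _ _ h

instance : Countable Instr := Instr.toNatList_injective.countable

theorem countable_polyTimeGenerated : {C | PolyTimeGenerated C}.Countable := by
  have : {C | PolyTimeGenerated C} ⊆ ⋃ P : Program, {C | ∃ p : Polynomial ℕ, ∀ n : ℕ,
      ∃ (b : Bool) (s : ℕ → List Bool),
        run (fun _ => false) P (p.eval n) 0 (initStacks (List.replicate n true) []) =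
          some (b, s) ∧ s 1 = (C n).code} := by
    rintro C ⟨P, h⟩
    exact Set.mem_iUnion.2 ⟨P, h⟩
  -- A program generates at most one family: its output does not depend on the time bound, and the
  -- code determines the circuit.
  refine (Set.countable_iUnion fun P => Set.Subsingleton.countable ?_).mono this
  rintro C ⟨p, hp⟩ C' ⟨p', hp'⟩
  funext n
  obtain ⟨b, s, h, hs⟩ := hp n
  obtain ⟨b', s', h', hs'⟩ := hp' n
  obtain ⟨-, rfl⟩ := Prod.ext_iff.1 (run_unique h h')
  exact Circuit.code_injective (hs.symm.trans hs')

theorem PolyTimeGenerated.exists_length_le {C : ℕ → Circuit} (hC : PolyTimeGenerated C) :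
    ∃ p : Polynomial ℕ, ∀ n, (C n).gates.length ≤ p.eval n := by
  obtain ⟨P, p, hp⟩ := hC
  refine ⟨p, fun n => ?_⟩
  obtain ⟨b, s, h, hs⟩ := hp n
  have := length_le_of_run h 1
  simp only [hs] at this
  exact (C n).length_gates_le.trans (by simpa [initStacks] using this)

theorem eventually_eval_le_two_pow (p : Polynomial ℕ) :
    ∀ᶠ n : ℕ in Filter.atTop, p.eval n ≤ 2 ^ n := by
  have h : (fun n : ℕ => ((p.eval n : ℕ) : ℝ)) =o[Filter.atTop] fun n : ℕ => (2 : ℝ) ^ n := by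
    induction p using Polynomial.induction_on' with
    | add p q hp hq => simpa using hp.add hq
    | monomial d a =>
      simp only [Polynomial.eval_monomial, Nat.cast_mul, Nat.cast_pow]
      exact (isLittleO_pow_const_const_pow_of_one_lt d one_lt_two).const_mul_left _
  filter_upwards [h.bound zero_lt_one] with n hn
  simp only [Real.norm_natCast, norm_pow, Real.norm_ofNat, one_mul] at hn
  exact_mod_cast hn

/-! ### Lower bounds -/

theorem two_mul_card_filter_apply_eq {n : ℕ} (i : Fin n) (c : Bool) :
    2 * (Finset.univ.filter fun z : Fin n → Bool => z i = c).card = 2 ^ n := by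
  have h := Finset.card_filter_add_card_filter_not (s := (Finset.univ : Finset (Fin n → Bool)))
    fun z => z i = c
  have h' : (Finset.univ.filter fun z : Fin n → Bool => z i = c).card =
      (Finset.univ.filter fun z : Fin n → Bool => ¬ z i = c).card := by
    refine Finset.card_nbij' (fun z => Function.update z i (!z i))
      (fun z => Function.update z i (!z i)) ?_ ?_ ?_ ?_ <;> intro z <;> simp
    exact Bool.eq_not_of_ne
  rw [← h', Finset.card_univ, Fintype.card_fun, Fintype.card_bool, Fintype.card_fin] at h
  omega

/-- The circuit accepts `u` with the right probability for the membership in the language of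
hidden first bits. -/
def DecidesFirstBit (U : ((n : ℕ) → Fin n → Bool) → QuantumOracle) (C : Circuit) (n : ℕ)
    (u : List Bool) : Set ((n : ℕ) → Fin n → Bool) :=
  {x | ((List.ofFn (x n)).head? = some true → 2 / 3 ≤ C.acceptProb (U x) u) ∧
    (¬ (List.ofFn (x n)).head? = some true → C.acceptProb (U x) u ≤ 1 / 3)}

section LowerBound

variable {U : ((n : ℕ) → Fin n → Bool) → QuantumOracle}

theorem dependsOn_decidesFirstBit (hU : HidesStrings U) (C : Circuit) (n : ℕ) (u : List Bool) :
    DependsOn (fun x => x ∈ DecidesFirstBit U C n u) (Set.Iio (max n C.width + 1)) := by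
  intro x y hxy
  have h₁ : x n = y n := hxy n (by simp)
  have h₂ : C.acceptProb (U x) u = C.acceptProb (U y) u :=
    C.acceptProb_congr (fun m hm => hU.congr x y m (hxy m (by simp; omega))) u
  simp only [DecidesFirstBit, Set.mem_ofPred_eq, h₁, h₂]

/-- If the acceptance probability is within 1/6 of the `z`-independent value `p₀`, a correct answer
forces the first bit of `z` to be 1 exactly when `p₀ ≥ 1/2`. This holds for half of the strings, and
the exceptional ones are at most a quarter, as `2304 = 4 · 576`. -/
theorem ncard_decidesFirstBit_le (hU : HidesStrings U) (C : Circuit) {n : ℕ} (hn : 0 < n)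
    (u : List Bool) (hC : 2304 * C.gates.length ^ 2 ≤ 2 ^ n) (x : (n : ℕ) → Fin n → Bool) :
    4 * {z | Function.update x n z ∈ DecidesFirstBit U C n u}.ncard ≤ 3 * 2 ^ n := by
  classical
  obtain ⟨k, rfl⟩ : ∃ k, n = k + 1 := ⟨n - 1, by omega⟩
  set p₀ := C.acceptProb (Function.update (U x) (k + 1) 1) u with hp₀
  have hsub : {z | Function.update x (k + 1) z ∈ DecidesFirstBit U C (k + 1) u} ⊆
      ((Finset.univ.filter fun z : Fin (k + 1) → Bool => z 0 = decide (1 / 2 ≤ p₀)) ∪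
        Finset.univ.filter fun z : Fin (k + 1) → Bool =>
          1 / 6 ≤ |C.acceptProb (U (Function.update x (k + 1) z)) u - p₀| : Finset _) := by
    rintro z ⟨h₁, h₂⟩
    simp only [Function.update_self, List.ofFn_succ, List.head?_cons, Option.some.injEq] at h₁ h₂
    rw [Finset.mem_coe, Finset.mem_union, Finset.mem_filter, Finset.mem_filter]
    by_contra! hcon
    obtain ⟨hz, hp⟩ := hcon
    have hz := hz (Finset.mem_univ z)
    have hp := abs_lt.1 (hp (Finset.mem_univ z))
    rcases h0 : z 0
    · have := h₂ (by simp [h0])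
      rw [h0] at hz
      simp at hz
      linarith
    · have := h₁ h0
      rw [h0] at hz
      simp at hz
      linarith
  have h := (Set.ncard_le_ncard hsub (Finset.finite_toSet _)).trans_eq (Set.ncard_coe_finset _)
  have h₁ := two_mul_card_filter_apply_eq (0 : Fin (k + 1)) (decide (1 / 2 ≤ p₀))
  have h₂ := hU.card_acceptProb_le C u x (k + 1)
  rw [← hp₀] at h₂
  have h₃ := h.trans (Finset.card_union_le _ _)
  omega

theorem hiddenLaw_decides_eq_zero (hU : HidesStrings U) {L : Language Bool}
    (hL : Set.Infinite {y : List Bool | y ∈ L}) {C : ℕ → Circuit} (hC : PolyTimeGenerated C) :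
    hiddenLaw {x | ∀ u : List Bool,
      (u ∈ hiddenLanguage x L → 2 / 3 ≤ (C u.length).acceptProb (U x) u) ∧
      (u ∉ hiddenLanguage x L → (C u.length).acceptProb (U x) u ≤ 1 / 3)} = 0 := by
  obtain ⟨p, hp⟩ := hC.exists_length_le
  obtain ⟨M, hM⟩ := Filter.eventually_atTop.1 (eventually_eval_le_two_pow (2304 * p ^ 2))
  refine hiddenLaw_eq_zero fun N => ?_
  -- Only finitely many strings are shorter than a given length, so the infinite `L` has a long one.
  -- A single input at that length suffices for the constraint.
  obtain ⟨u, hu, hlen⟩ : ∃ u ∈ L, max (max N M) 1 ≤ u.length := by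
    by_contra! hcon
    exact hL ((List.finite_length_lt Bool _).subset hcon)
  simp only [max_le_iff] at hlen
  refine ⟨u.length, hlen.1.1, _, DecidesFirstBit U (C u.length) u.length u, ?_,
    dependsOn_decidesFirstBit hU _ _ _, ncard_decidesFirstBit_le hU _ hlen.2 u ?_⟩
  · intro x hx
    obtain ⟨h₁, h₂⟩ := hx u
    exact ⟨fun h => h₁ ⟨hu, h⟩, fun h => h₂ fun hmem => h hmem.2⟩
  · refine le_trans ?_ (hM _ hlen.1.2)
    have := hp u.length
    simp only [Polynomial.eval_mul, Polynomial.eval_pow, Polynomial.eval_ofNat]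
    gcongr

theorem ae_hiddenLanguage_notMem_BQP (hU : HidesStrings U) {L : Language Bool}
    (hL : Set.Infinite {y : List Bool | y ∈ L}) :
    ∀ᵐ x ∂hiddenLaw, hiddenLanguage x L ∉ BQP (U x) := by
  have h : ∀ᵐ x ∂hiddenLaw, ∀ C ∈ {C | PolyTimeGenerated C}, ¬ ∀ u : List Bool,
      (u ∈ hiddenLanguage x L → 2 / 3 ≤ (C u.length).acceptProb (U x) u) ∧
      (u ∉ hiddenLanguage x L → (C u.length).acceptProb (U x) u ≤ 1 / 3) := by
    rw [ae_ball_iff countable_polyTimeGenerated]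
    intro C hC
    rw [ae_iff]
    simp only [not_not]
    exact hiddenLaw_decides_eq_zero hU hL hC
  filter_upwards [h] with x hx
  rintro ⟨C, hC, -, hu⟩
  exact hx C hC hu

end LowerBound

/-! ### A quantum circuit verifying the hidden string -/

/-- The wires of the oracle call in `verifierCircuit n`: the input on the qubits `0, …, n - 1` is
its second register, the witness on the qubits `n, …, 2n - 1` its first register. -/
def verifierWires (n : ℕ) : OracleWire n ↪ Fin (2 * n + 2 + 1) where
  toFun
    | Sum.inl i => ⟨n + i, by omega⟩
    | Sum.inr (Sum.inl i) => ⟨i, by omega⟩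
    | Sum.inr (Sum.inr ()) => ⟨2 * n + 1, by omega⟩
  inj' := by
    rintro (i | i | ⟨⟩) (j | j | ⟨⟩) h <;> simp only [Fin.mk.injEq] at h <;>
      first | rfl | omega | (congr; ext; omega)

@[simp] theorem val_verifierWires_fst {n : ℕ} (i : Fin n) :
    (verifierWires n (Sum.inl i) : ℕ) = n + i := rfl

@[simp] theorem val_verifierWires_snd {n : ℕ} (i : Fin n) :
    (verifierWires n (Sum.inr (Sum.inl i)) : ℕ) = i := rfl

@[simp] theorem val_verifierWires_bit (n : ℕ) :
    (verifierWires n (Sum.inr (Sum.inr ())) : ℕ) = 2 * n + 1 := rfl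

/-- Hadamard gates on the witness. -/
def witnessHadamards (n : ℕ) : List (Gate (2 * n + 2 + 1)) :=
  (List.finRange n).map fun i => .hadamard (verifierWires n (Sum.inl i))

/-- The circuit that computes on its last qubit the conjunction of the first bit of the witness and
of the value at the witness and the input of the function hidden in the oracle. -/
def verifierCircuit (n : ℕ) : Circuit where
  width := 2 * n + 2
  gates := witnessHadamards n ++ .oracle n (verifierWires n) :: (witnessHadamards n ++
    -- Qubit `2n` stays idle. It keeps the three qubits distinct for `n = 0`, when qubit `n` is
    -- qubit `2n`, holds 0 and so makes the circuit reject.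
    [.toffoli ⟨n, by omega⟩ ⟨2 * n + 1, by omega⟩ ⟨2 * n + 2, by omega⟩
      (by simp; omega) (by simp; omega) (by simp)])

theorem foldl_hadamard_act (U : QuantumOracle) {N : ℕ} {W : Type*} [Fintype W] [DecidableEq W]
    (q : W ↪ Fin N) (l : List W) (hl : l.Nodup) (ψ : (Fin N → Bool) → ℂ) :
    (l.map fun j => Gate.hadamard (q j)).foldl (fun ψ g => g.act U ψ) ψ =
      liftAct (tensorMatrix fun k => if k ∈ l then hadamardMatrix else 1) q ψ := by
  induction l generalizing ψ with
  | nil =>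
    simp only [List.map_nil, List.foldl_nil, List.not_mem_nil, if_false]
    exact (congrArg (fun M => liftAct M q ψ) tensorMatrix_one |>.trans (liftAct_one q ψ)).symm
  | cons j l ih =>
    obtain ⟨hj, hl⟩ := List.nodup_cons.1 hl
    rw [List.map_cons, List.foldl_cons, ih hl, hadamard_act_eq_liftAct, ← liftAct_mul,
      tensorMatrix_mul]
    congr 2
    funext k
    by_cases hk : k = j
    · subst hk; simp [hj]
    · simp [hk]

theorem foldl_witnessHadamards (U : QuantumOracle) (n : ℕ)
    (ψ : (Fin (2 * n + 2 + 1) → Bool) → ℂ) :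
    (witnessHadamards n).foldl (fun ψ g => g.act U ψ) ψ =
      liftAct (hadamardFst n) (verifierWires n) ψ := by
  have h := foldl_hadamard_act U (verifierWires n) ((List.finRange n).map Sum.inl)
    ((List.nodup_finRange n).map Sum.inl_injective) ψ
  rw [List.map_map] at h
  refine h.trans ?_
  rw [hadamardFst_eq_tensorMatrix]
  congr 2
  funext k
  rcases k with k | k <;> simp

theorem liftAct_toQuantum (f : BoolOracle) {n N : ℕ} (q : OracleWire n ↪ Fin N)
    (ψ : (Fin N → Bool) → ℂ) (b : Fin N → Bool) :
    liftAct (f.toQuantum n) q ψ b =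
      ψ (Function.update b (q (Sum.inr (Sum.inr ()))) (xor (b (q (Sum.inr (Sum.inr ()))))
        (f n (fun i => b (q (Sum.inl i))) fun i => b (q (Sum.inr (Sum.inl i)))))) := by
  rw [liftAct_apply, toQuantum_mulVec, xorTarget, extend_embedding_update]
  rfl

/-- The Hadamard gates cancel the conjugation, `H (H O H) H = O`, so what remains permutes basis
states. -/
theorem finalState_verifierCircuit (f : BoolOracle) (n : ℕ) (u : List Bool) :
    (verifierCircuit n).finalState f.toQuantum.hadamardConj u =
      (Gate.toffoli ⟨n, by omega⟩ ⟨2 * n + 1, by omega⟩ ⟨2 * n + 2, by omega⟩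
        (by simp; omega) (by simp; omega) (by simp)).act f.toQuantum.hadamardConj
        (liftAct (f.toQuantum n) (verifierWires n)
          (Pi.single (fun i : Fin (2 * n + 2 + 1) => u.getD i false) 1)) := by
  simp only [Circuit.finalState, verifierCircuit, List.foldl_append, List.foldl_cons,
    List.foldl_nil]
  congr 1
  rw [foldl_witnessHadamards, foldl_witnessHadamards]
  have h : ∀ ψ, (Gate.oracle n (verifierWires n)).act f.toQuantum.hadamardConj ψ =
      liftAct (f.toQuantum.hadamardConj n) (verifierWires n) ψ := fun ψ => rfl
  rw [h, ← liftAct_mul, ← liftAct_mul, QuantumOracle.hadamardConj]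
  congr 1
  simp only [Matrix.mul_assoc, hadamardFst_mul_self, Matrix.mul_one]
  rw [← Matrix.mul_assoc, hadamardFst_mul_self, Matrix.one_mul]

theorem sum_if_single_involutive {α : Type*} [Fintype α] [DecidableEq α] (s : α → Bool)
    {σ τ : α → α} (hσ : Function.Involutive σ) (hτ : Function.Involutive τ) (a : α) :
    (∑ b, if s b then ‖(Pi.single a 1 : α → ℂ) (σ (τ b))‖ ^ 2 else 0) =
      if s (τ (σ a)) then 1 else (0 : ℝ) := by
  rw [Finset.sum_eq_single (τ (σ a))]
  · simp [hσ a, hτ (σ a)]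
  · intro b _ hb
    rw [Pi.single_eq_of_ne]
    · simp
    · rintro rfl
      exact hb (by rw [hσ, hτ])
  · simp

theorem acceptProb_verifierCircuit (f : BoolOracle) {n : ℕ} (u w : Fin n → Bool) :
    (verifierCircuit n).acceptProb f.toQuantum.hadamardConj (List.ofFn u ++ List.ofFn w) =
      if f n w u = true ∧ (List.ofFn w).head? = some true then 1 else 0 := by
  set l := List.ofFn u ++ List.ofFn w with hl
  set b₀ : Fin (2 * n + 2 + 1) → Bool := fun i => l.getD i false with hb₀
  set e : (Fin (2 * n + 2 + 1) → Bool) → Bool := fun b =>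
    f n (fun i => b (verifierWires n (Sum.inl i)))
      fun i => b (verifierWires n (Sum.inr (Sum.inl i))) with he
  set t : Fin (2 * n + 2 + 1) := ⟨2 * n + 1, by omega⟩ with ht
  set c : Fin (2 * n + 2 + 1) := ⟨n, by omega⟩ with hc
  have hlast : Fin.last (2 * n + 2) = ⟨2 * n + 2, by omega⟩ := rfl
  have hct : c ≠ t := by simp [hc, ht]; omega
  have hco : c ≠ Fin.last (2 * n + 2) := by simp [hc, hlast]; omega
  have hto : t ≠ Fin.last (2 * n + 2) := by simp [ht, hlast]
  have hwt : verifierWires n (Sum.inr (Sum.inr ())) = t := rfl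
  have hσ := xor_update_involutive t e (by
    intro b d
    simp only [he, ← hwt]
    congr 1 <;> funext i <;> rw [Function.update_of_ne] <;> simp)
  have hτ := xor_update_involutive (Fin.last (2 * n + 2)) (fun b => b c && b t)
    (by simp [hco, hto])
  have hsum := sum_if_single_involutive (fun b => b (Fin.last (2 * n + 2))) hσ hτ b₀
  have hprob : (verifierCircuit n).acceptProb f.toQuantum.hadamardConj l = if
      (fun b => Function.update b (Fin.last (2 * n + 2)) (xor (b (Fin.last (2 * n + 2)))
        (b c && b t))) (Function.update b₀ t (xor (b₀ t) (e b₀))) (Fin.last (2 * n + 2)) = true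
      then 1 else 0 := by
    rw [← hsum]
    simp only [Circuit.acceptProb, finalState_verifierCircuit]
    refine Finset.sum_congr rfl fun b _ => ?_
    simp only [Gate.act, liftAct_toQuantum]
    rfl
  rw [hprob]
  have hlen : l.length = 2 * n := by simp [hl]; omega
  have hb₀t : b₀ t = false := by
    simp only [hb₀, ht]
    exact List.getD_eq_default _ _ (by omega)
  have hb₀o : b₀ (Fin.last (2 * n + 2)) = false := by
    simp only [hb₀, hlast]
    exact List.getD_eq_default _ _ (by omega)
  have he₀ : e b₀ = f n w u := by
    simp only [he, hb₀]
    congr 1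
    · funext i
      simp [hl, List.getD_eq_getElem?_getD]
    · funext i
      simp [hl, List.getD_eq_getElem?_getD, List.getElem?_append_left]
  have hb₀c : b₀ c = true ↔ (List.ofFn w).head? = some true := by
    simp only [hb₀, hc, hl, List.getD_eq_getElem?_getD]
    rw [List.getElem?_append_right (by simp), List.length_ofFn, Nat.sub_self,
      ← List.head?_eq_getElem?]
    rcases (List.ofFn w).head? with _ | _ | _ <;> simp
  simp only [Function.update_self, Function.update_of_ne hct, Function.update_of_ne hto.symm,
    hb₀t, hb₀o, he₀, Bool.false_xor, Bool.and_eq_true, hb₀c]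
  simp only [and_comm]

open Classical in
theorem acceptProb_verifierCircuit_hadamardOracle (x : (n : ℕ) → Fin n → Bool) (L : Language Bool)
    {u w : List Bool} (h : w.length = u.length) :
    (verifierCircuit u.length).acceptProb (hadamardOracle x L) (u ++ w) =
      if w = List.ofFn (x u.length) ∧ u ∈ hiddenLanguage x L then 1 else 0 := by
  obtain ⟨n, rfl⟩ : ∃ n, n = u.length := ⟨_, rfl⟩
  obtain ⟨w', rfl⟩ : ∃ w' : Fin u.length → Bool, w = List.ofFn w' := by
    rw [← h]
    exact ⟨w.get, by simp⟩
  have hacc := acceptProb_verifierCircuit (hiddenBit x L) (fun i => u.get i) w'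
  rw [List.ofFn_get] at hacc
  refine hacc.trans (if_congr ?_ rfl rfl)
  simp only [hiddenBit, decide_eq_true_eq, List.ofFn_get, mem_hiddenLanguage, and_assoc]
  constructor
  · rintro ⟨rfl, hu⟩
    exact ⟨rfl, hu⟩
  · rintro ⟨hw, hu⟩
    exact ⟨List.ofFn_injective hw, hw ▸ hu⟩

theorem hiddenLanguage_mem_QCMA (hgen : PolyTimeGenerated verifierCircuit)
    (x : (n : ℕ) → Fin n → Bool) (L : Language Bool) :
    hiddenLanguage x L ∈ QCMA (hadamardOracle x L) := by
  refine ⟨verifierCircuit, Polynomial.X, hgen, fun n => ?_,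
    fun u => ⟨fun hu => ?_, fun hu w hw => ?_⟩⟩
  · simp [verifierCircuit]
    omega
  · refine ⟨List.ofFn (x u.length), by simp, ?_⟩
    rw [acceptProb_verifierCircuit_hadamardOracle _ _ (by simp), if_pos ⟨rfl, hu⟩]
    norm_num
  · rw [acceptProb_verifierCircuit_hadamardOracle _ _ (by simpa using hw),
      if_neg fun h => hu h.2]
    norm_num

/-! ### Programs from commands -/

/-- Commands: `push k b` pushes the bit `b` on stack `k`, `cat c d` runs `d` and then `c`, and
`loop k c` pops stack `k` and runs `c` as long as the popped bit is `true`. -/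
inductive Cmd : Type
  | push (k : ℕ) (b : Bool)
  | skip
  | cat (c d : Cmd)
  | loop (k : ℕ) (c : Cmd)

/-- The number of instructions of a command. -/
def Cmd.size : Cmd → ℕ
  | push _ _ => 1
  | skip => 0
  | cat c d => d.size + c.size
  | loop _ c => c.size + 2

/-- The instructions of a command, to be placed at the label `base`. -/
def Cmd.compile : Cmd → ℕ → Program
  | push k b, base => [.push k b (base + 1)]
  | skip, _ => []
  | cat c d, base => d.compile base ++ c.compile (base + d.size)
  | loop k c, base =>
    .pop k (base + (c.size + 2)) (base + (c.size + 2)) (base + 1) ::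
      -- A query with equal successors acts as an unconditional jump, whatever the answer.
      (c.compile (base + 1) ++ [.query 0 base base])

@[simp] theorem Cmd.length_compile (c : Cmd) (base : ℕ) : (c.compile base).length = c.size := by
  induction c generalizing base with
  | push k b => rfl
  | skip => rfl
  | cat c d hc hd => simp [compile, size, hc, hd]
  | loop k c hc => simp [compile, size, hc]

/-- The instructions `l` occur in the program `P` at the label `base`. -/
def CodeAt (P : Program) (base : ℕ) (l : Program) : Prop :=
  ∀ i < l.length, P[base + i]? = l[i]?

theorem CodeAt.left {P : Program} {base : ℕ} {l l' : Program} (h : CodeAt P base (l ++ l')) :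
    CodeAt P base l := by
  intro i hi
  rw [h i (by simp; omega), List.getElem?_append_left hi]

theorem CodeAt.right {P : Program} {base : ℕ} {l l' : Program} (h : CodeAt P base (l ++ l')) :
    CodeAt P (base + l.length) l' := by
  intro i hi
  have := h (l.length + i) (by simp; omega)
  rw [List.getElem?_append_right (by omega), Nat.add_sub_cancel_left] at this
  rw [← this, Nat.add_assoc]

/-- Wherever it is placed, the command changes the stacks from `s` to `s'` in at most `t` steps. -/
def Cmd.Runs (c : Cmd) (s s' : ℕ → List Bool) (t : ℕ) : Prop :=
  ∀ A P base, CodeAt P base (c.compile base) → Reach A P base s (base + c.size) s' t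

section Runs

variable {c d : Cmd} {s s' s'' : ℕ → List Bool} {t t' k : ℕ}

theorem Cmd.Runs.mono (h : c.Runs s s' t) (ht : t ≤ t') : c.Runs s s' t' :=
  fun A P base hP => (h A P base hP).mono ht

theorem Cmd.runs_push (k : ℕ) (b : Bool) (s : ℕ → List Bool) :
    (push k b).Runs s (Function.update s k (b :: s k)) 1 :=
  fun _ _ base hP => reach_push (next := base + 1) (by simpa [compile] using hP 0)

theorem Cmd.runs_skip (s : ℕ → List Bool) : skip.Runs s s 0 := fun _ _ _ _ => Reach.refl

theorem Cmd.Runs.cat (hd : d.Runs s s' t) (hc : c.Runs s' s'' t') :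
    (cat c d).Runs s s'' (t + t') := by
  intro A P base hP
  have h := hc A P (base + d.size) (by simpa using CodeAt.right hP)
  rw [Nat.add_assoc] at h
  exact (hd A P base hP.left).trans h

theorem Cmd.runs_loop_nil (h : s k = []) : (loop k c).Runs s s 1 := by
  intro A P base hP
  have h₀ : P[base]? = some (.pop k (base + (c.size + 2)) (base + (c.size + 2)) (base + 1)) := by
    simpa [compile] using hP 0 (by simp [compile])
  exact reach_pop_nil h₀ h

theorem Cmd.Runs.loop_cons {r : List Bool} (h : s k = true :: r)
    (hc : c.Runs (Function.update s k r) s' t) (hl : (loop k c).Runs s' s'' t') :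
    (loop k c).Runs s s'' (t + t' + 2) := by
  intro A P base hP
  have h₀ : P[base]? = some (.pop k (base + (c.size + 2)) (base + (c.size + 2)) (base + 1)) := by
    simpa [compile] using hP 0 (by simp [compile])
  have hP' : CodeAt P (base + 1) (c.compile (base + 1) ++ [.query 0 base base]) :=
    CodeAt.right (l := [.pop k (base + (c.size + 2)) (base + (c.size + 2)) (base + 1)]) hP
  have h₁ : P[base + 1 + c.size]? = some (.query 0 base base) := by
    simpa using hP'.right 0
  have h₂ := (reach_pop_cons (A := A) h₀ h).trans (hc A P (base + 1) hP'.left)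
  have h₃ := reach_query (A := A) (s := s') h₁
  rw [ite_self] at h₃
  exact ((h₂.trans h₃).trans (hl A P base hP)).mono (by omega)

end Runs

/-- A command that adds stack `k` to stack `d` in unary, with stack `2` as an auxiliary stack. -/
def Cmd.add (k d : ℕ) : Cmd :=
  .cat (.loop 2 (.push k true)) (.loop k (.cat (.push 2 true) (.push d true)))

section Add

variable {s : ℕ → List Bool} {m k d : ℕ}

theorem Cmd.runs_loop_push_push (hkd : k ≠ d) (hk : k ≠ 2) (hd : d ≠ 2)
    (hs : s k = List.replicate m true) :
    (loop k (cat (push 2 true) (push d true))).Runs s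
      (Function.update (Function.update (Function.update s k []) d (List.replicate m true ++ s d)) 2
        (List.replicate m true ++ s 2)) (4 * m + 1) := by
  induction m generalizing s with
  | zero =>
    have : Function.update (Function.update (Function.update s k []) d
        (List.replicate 0 true ++ s d)) 2 (List.replicate 0 true ++ s 2) = s := by
      rw [Function.update_eq_self_iff (a := k) |>.2 (by simpa using hs.symm)]
      simp
    rw [this]
    exact runs_loop_nil hs
  | succ m ih =>
    have h := Cmd.Runs.loop_cons hs ((runs_push d true _).cat (runs_push 2 true _))
      (ih (by simp [hkd, hk]))
    convert h using 1
    · funext j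
      by_cases h2 : j = 2
      · subst h2
        simp [hk.symm, hd.symm, List.replicate_succ']
      · by_cases hjd : j = d
        · subst hjd
          simp [hd, hkd.symm, List.replicate_succ']
        · by_cases hjk : j = k
          · subst hjk
            simp [hk, hkd]
          · simp [h2, hjd, hjk]
    · omega

theorem Cmd.runs_loop_push (hk : k ≠ 2) (hs : s 2 = List.replicate m true) :
    (loop 2 (push k true)).Runs s
      (Function.update (Function.update s 2 []) k (List.replicate m true ++ s k)) (3 * m + 1) := by
  induction m generalizing s with
  | zero =>
    have : Function.update (Function.update s 2 []) k (List.replicate 0 true ++ s k) = s := by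
      rw [Function.update_eq_self_iff (a := 2) |>.2 (by simpa using hs.symm)]
      simp
    rw [this]
    exact runs_loop_nil hs
  | succ m ih =>
    have h := Cmd.Runs.loop_cons hs (runs_push k true _) (ih (by simp [hk.symm]))
    convert h using 1
    · funext j
      by_cases hjk : j = k
      · subst hjk
        simp [hk, List.replicate_succ']
      · by_cases h2 : j = 2
        · subst h2
          simp [hk.symm]
        · simp [h2, hjk]
    · omega

theorem Cmd.runs_add (hkd : k ≠ d) (hk : k ≠ 2) (hd : d ≠ 2)
    (hs : s k = List.replicate m true) (h2 : s 2 = []) :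
    (add k d).Runs s (Function.update s d (List.replicate m true ++ s d)) (7 * m + 2) := by
  -- Stack `k` is drained into `d` and the auxiliary stack, then refilled from the latter, in `(4m +
  -- 1) + (3m + 1)` steps.
  have h := (runs_loop_push_push hkd hk hd hs).cat (runs_loop_push (m := m) hk (by simp [h2]))
  unfold add
  convert h using 1
  · funext j
    by_cases h2' : j = 2
    · subst h2'
      simp [hk.symm, hd.symm, h2]
    · by_cases hjd : j = d
      · subst hjd
        simp [hd, hkd.symm]
      · by_cases hjk : j = k
        · subst hjk
          simp [hk, hkd, hs]
        · simp [h2', hjd, hjk]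
  · omega

end Add

/-! ### Printing circuits -/

/-- With `n` and `j` in unary on the stacks `0` and `3` such that `R n j`, the command prepends the
string `f n j` to stack `1` in time polynomial in `n`. -/
def Cmd.Prints (R : ℕ → ℕ → Prop) (c : Cmd) (f : ℕ → ℕ → List Bool) : Prop :=
  ∃ p : Polynomial ℕ, ∀ n j, R n j → ∀ o,
    c.Runs (fourStacks (List.replicate n true) o [] (List.replicate j true))
      (fourStacks (List.replicate n true) (f n j ++ o) [] (List.replicate j true)) (p.eval n)

/-- A command that prints a fixed string. -/
def Cmd.print : List Bool → Cmd
  | [] => .skip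
  | b :: l => .cat (.push 1 b) (print l)

/-- A command that runs `c` with each number less than `n` on stack `3`, in decreasing order. -/
def Cmd.forLoop (c : Cmd) : Cmd := .cat (.loop 3 c) (.add 0 3)

section Prints

variable {R : ℕ → ℕ → Prop} {c d : Cmd} {f g : ℕ → ℕ → List Bool}

/-- Output is prepended, so running `d` before `c` makes the printed strings appear in the order in
which the command is written. -/
theorem Cmd.Prints.cat (hc : c.Prints R f) (hd : d.Prints R g) :
    (cat c d).Prints R fun n j => f n j ++ g n j := by
  obtain ⟨p, hp⟩ := hc
  obtain ⟨q, hq⟩ := hd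
  refine ⟨q + p, fun n j hj o => ?_⟩
  rw [Polynomial.eval_add, List.append_assoc]
  exact (hq n j hj o).cat (hp n j hj _)

theorem Cmd.prints_print (l : List Bool) : (print l).Prints R fun _ _ => l := by
  induction l with
  | nil => exact ⟨0, fun n j _ o => by simpa [print] using runs_skip _⟩
  | cons b l ih =>
    exact Prints.cat (f := fun _ _ => [b])
      ⟨1, fun n j _ o => by
        simpa using runs_push 1 b (fourStacks (List.replicate n true) o [] (List.replicate j true))⟩
      ih

theorem Cmd.prints_add_zero : (add 0 1).Prints R fun n _ => List.replicate n true := by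
  refine ⟨7 * Polynomial.X + 2, fun n j _ o => ?_⟩
  simpa using runs_add (k := 0) (d := 1) (m := n)
    (s := fourStacks (List.replicate n true) o [] (List.replicate j true))
    (by norm_num) (by norm_num) (by norm_num) rfl rfl

theorem Cmd.prints_add_three :
    (add 3 1).Prints (fun n j => j < n) fun _ j => List.replicate j true := by
  refine ⟨7 * Polynomial.X + 2, fun n j hj o => ?_⟩
  have h := runs_add (k := 3) (d := 1) (m := j)
    (s := fourStacks (List.replicate n true) o [] (List.replicate j true))
    (by norm_num) (by norm_num) (by norm_num) rfl rfl
  simpa using h.mono (t' := 7 * n + 2) (by omega)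

/-- The loop pops its counter before the body runs, so the body sees `n - 1, …, 0`; prepending turns
this into increasing order. The counter stack ends empty, ready for another loop. -/
theorem Cmd.Prints.forLoop (hc : c.Prints (fun n j => j < n) f) :
    c.forLoop.Prints (fun _ j => j = 0) fun n _ => (List.range n).flatMap (f n) := by
  obtain ⟨p, hp⟩ := hc
  have key : ∀ n m, m ≤ n → ∀ o, (Cmd.loop 3 c).Runs
      (fourStacks (List.replicate n true) o [] (List.replicate m true))
      (fourStacks (List.replicate n true) ((List.range m).flatMap (f n) ++ o) [] [])
      (m * (p.eval n + 2) + 1) := by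
    intro n m
    induction m with
    | zero => exact fun _ o => by simpa using Cmd.runs_loop_nil rfl
    | succ m ih =>
      intro hm o
      have h₁ := hp n m hm o
      have h₂ := ih (by omega) (f n m ++ o)
      refine (Cmd.Runs.loop_cons (k := 3) (r := List.replicate m true) rfl
        (by simpa using h₁) (by simpa [List.range_succ] using h₂)).mono ?_
      rw [Nat.succ_mul]
      omega
  refine ⟨7 * Polynomial.X + 2 + (Polynomial.X * (p + 2) + 1), ?_⟩
  rintro n _ rfl o
  have h := Cmd.runs_add (k := 0) (d := 3) (m := n)
    (s := fourStacks (List.replicate n true) o [] [])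
    (by norm_num) (by norm_num) (by norm_num) rfl rfl
  simp only [update_fourStacks_three, fourStacks_three, List.append_nil] at h
  simpa [Cmd.forLoop] using h.cat (key n n le_rfl o)

theorem Cmd.Prints.polyTimeGenerated (hc : c.Prints (fun _ j => j = 0) f) {C : ℕ → Circuit}
    (hC : ∀ n, (C n).code = f n 0) : PolyTimeGenerated C := by
  obtain ⟨p, hp⟩ := hc
  refine ⟨c.compile 0 ++ [.halt true], p + 1, fun n => ?_⟩
  have h := hp n 0 rfl [] (fun _ => false) (c.compile 0 ++ [.halt true]) 0
    (fun i hi => by rw [Nat.zero_add, List.getElem?_append_left hi])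
  refine ⟨true, fourStacks (List.replicate n true) (f n 0 ++ []) [] [], ?_, ?_⟩
  · rw [initStacks_eq_fourStacks]
    refine h.run_halt (b := true) ?_ (by simp)
    rw [Nat.zero_add, List.getElem?_append_right (by simp)]
    simp
  · simp [hC]

end Prints

/-- A command that prints the Hadamard gates on the witness. -/
def printHadamards : Cmd :=
  (Cmd.cat (.print [false]) (.cat (.add 0 1) (.cat (.add 3 1) (.print [false])))).forLoop

/-- A command that prints the verifier circuit. -/
def printVerifier : Cmd :=
  -- In order: the width `2n + 2`; the Hadamards; opcode 4 and `n`; the wires `n + i`, `i` and `2n +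
  -- 1` of the call; the Hadamards again; opcode 3 and the qubits `n`, `2n + 1`, `2n + 2`.
  .cat (.print [true, true]) <| .cat (.add 0 1) <| .cat (.add 0 1) <| .cat (.print [false]) <|
  .cat printHadamards <|
  .cat (.print [true, true, true, true, false]) <| .cat (.add 0 1) <| .cat (.print [false]) <|
  .cat (Cmd.cat (.add 0 1) (.cat (.add 3 1) (.print [false]))).forLoop <|
  .cat (Cmd.cat (.add 3 1) (.print [false])).forLoop <|
  .cat (.print [true]) <| .cat (.add 0 1) <| .cat (.add 0 1) <| .cat (.print [false]) <|
  .cat printHadamards <|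
  .cat (.print [true, true, true, false]) <| .cat (.add 0 1) <| .cat (.print [false]) <|
  .cat (.print [true]) <| .cat (.add 0 1) <| .cat (.add 0 1) <| .cat (.print [false]) <|
  .cat (.print [true, true]) <| .cat (.add 0 1) <| .cat (.add 0 1) (.print [false])

theorem witnessHadamards_flatMap_data (n : ℕ) :
    (witnessHadamards n).flatMap Gate.data = (List.range n).flatMap fun j => [0, n + j] := by
  rw [witnessHadamards, List.flatMap_map, ← List.map_coe_finRange_eq_range, List.flatMap_map]
  rfl

theorem ofFn_eq_range_map {α : Type*} (n : ℕ) (g : ℕ → α) :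
    (List.ofFn fun i : Fin n => g i) = (List.range n).map g := by
  rw [List.ofFn_eq_map, ← List.map_coe_finRange_eq_range, List.map_map]
  rfl

theorem polyTimeGenerated_verifierCircuit : PolyTimeGenerated verifierCircuit := by
  have hH := (Cmd.prints_print [false]).cat (Cmd.prints_add_zero.cat
    (Cmd.prints_add_three.cat (Cmd.prints_print [false]))) |>.forLoop
  have hw := Cmd.prints_add_zero.cat
    (Cmd.prints_add_three.cat (Cmd.prints_print [false])) |>.forLoop
  have hu := Cmd.prints_add_three.cat (Cmd.prints_print [false]) |>.forLoop
  have hb (l : List Bool) := Cmd.prints_print (R := fun _ j => j = 0) l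
  have hn := Cmd.prints_add_zero (R := fun _ j => j = 0)
  have h : printVerifier.Prints (fun _ j => j = 0) _ :=
    (hb _).cat <| hn.cat <| hn.cat <| (hb _).cat <| hH.cat <| (hb _).cat <| hn.cat <|
    (hb _).cat <| hw.cat <| hu.cat <| (hb _).cat <| hn.cat <| hn.cat <| (hb _).cat <| hH.cat <|
    (hb _).cat <| hn.cat <| (hb _).cat <| (hb _).cat <| hn.cat <| hn.cat <| (hb _).cat <|
    (hb _).cat <| hn.cat <| hn.cat <| hb _
  refine h.polyTimeGenerated fun n => ?_
  have h₁ : List.replicate (2 * n + 1) true =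
      true :: (List.replicate n true ++ List.replicate n true) := by
    rw [two_mul, List.replicate_succ, List.replicate_add]
  have h₂ : List.replicate (2 * n + 2) true =
      true :: true :: (List.replicate n true ++ List.replicate n true) := by
    rw [List.replicate_succ, h₁]
  simp only [Circuit.code, verifierCircuit, List.flatMap_append, List.flatMap_cons,
    witnessHadamards_flatMap_data, Gate.data, val_verifierWires_fst, val_verifierWires_snd,
    val_verifierWires_bit, ofFn_eq_range_map n fun i => n + i, ofFn_eq_range_map n fun i => i,
    List.flatMap_nil, List.flatMap_assoc, List.flatMap_map, h₁, h₂, List.replicate_add]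
  simp [List.replicate_succ, -List.replicate_append_replicate]

end MarkedOracle

/-! ### The three separations -/

theorem mainTheorem3 (L : Language Bool) (hL : Set.Infinite {y : List Bool | y ∈ L}) :
    ∀ᵐ x : (n : ℕ) → Fin n → Bool ∂MarkedOracle.hiddenLaw,
      ¬ MarkedOracle.NP (MarkedOracle.hiddenBit x L) ⊆
          MarkedOracle.BQP (MarkedOracle.standardOracle x L) ∧
      ¬ MarkedOracle.PPoly (MarkedOracle.hiddenBit x L) ⊆
          MarkedOracle.BQP (MarkedOracle.standardOracle x L) ∧
      ¬ MarkedOracle.QCMA (MarkedOracle.hadamardOracle x L) ⊆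
          MarkedOracle.BQP (MarkedOracle.hadamardOracle x L) := by
  filter_upwards [
    MarkedOracle.ae_hiddenLanguage_notMem_BQP (MarkedOracle.hidesStrings_standardOracle L) hL,
    MarkedOracle.ae_hiddenLanguage_notMem_BQP (MarkedOracle.hidesStrings_hadamardOracle L) hL]
    with x hO hU
  exact ⟨fun h => hO (h (MarkedOracle.hiddenLanguage_mem_NP x L)),
    fun h => hO (h (MarkedOracle.hiddenLanguage_mem_PPoly x L)),
    fun h => hU (h (MarkedOracle.hiddenLanguage_mem_QCMA
      MarkedOracle.polyTimeGenerated_verifierCircuit x L))⟩
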